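/- Let $(\Omega_1,\nu)$ and $(\Omega_2,\mu)$ be finite measure spaces and $1\le p<\infty$. A Banach function space $X(\nu)$ is a Banach space $X(\nu)\subseteq L^0(\nu)$ that contains all simple functions and such that $|f|\le|g|$, $g\in X(\nu)$ imply $f\in X(\nu)$ and $\|f\|\le\|g\|$; it is order continuous if $f_n\downarrow 0$ in $X(\nu)$ implies $\|f_n\|\to0$. For a vector measure $m$ with values in a Banach space $E$, $L^1(m)$ is the space of measurable $f$ that are integrable with respect to $\langle m,x^*\rangle$ for every $x^*\in E^*$ and for which, for every measurable $A$, there is $\int_A f\,dm\in E$ with $\langle \int_A f\,dm,x^*\rangle=\int_A f\,d\langle m,x^*\rangle$ for all $x^*$; $\|f\|_{L^1(m)}=\sup_{\|x^*\|\le1}\int|f|\,d|\langle m,x^*\rangle|$. Further $f\in L^p(m)$ iff $|f|^p\in L^1(m)$, and $\|f\|_{L^p(m)}=\||f|^p\|_{L^1(m)}^{1/p}$. Let $V\subset L^1(\mu)_+$ be relatively weakly compact, and let $m_V(A)=(\int_A v\,d\mu)_{v\in V}\in\ell^\infty(V)$, which is a vector measure. Then $L^p(m_V)$, with the norm $\sup_{v\in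 V}\|\cdot\|_{L^p(v\,d\mu)}$, is a closed subspace of the Banach space $Z$ of all bounded families $(y_v)_{v\in V}$ with $y_v\in L^p(v\,d\mu)$. Let $X(\nu)$ be an order continuous Banach function space and let $T$ be a linear operator from $X(\nu)$ to $L^0(\mu)$ with $\sup_{v\in V}\|T\|_{X(\nu)\to L^p(v\,d\mu)}<\infty$. Let $m_T(A)=T\chi_A$ be the vector measure of $T$, regarded as $Z$-valued, and let $(L^1(m_T))'$ and $(X(\nu))'$ be the Köthe duals with respect to $\nu$, that is, the spaces of $g\in L^0(\nu)$ with $fg\in L^1(\nu)$ for all $f\in L^1(m_T)$ (resp. $f\in X(\nu)$), normed by $\sup_{\|f\|\le1}\int fg\,d\nu$, with closed unit balls $B_{(L^1(m_T))'}$ and $B_{(X(\nu))'}$. A set $W\subset L^1(\nu)_+$ is conjugate to $V$ with respect to $T$ if the inclusions $X(\nu)\to L^p(w\,d\nu)$, $w\in W$, are uniformly bounded and there is a constant $C$ such that for every $v\in V$ there is $w\in W$ for which $T$ induces a bounded operator $L^p(w\,d\nu)\to L^p(v\,d\mu)$ of norm at most $C$. A set $W$ of non-negative elements of $B_{(L^1(m_T))'}$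 is positively norming if $f\mapsto\sup_{w\in W}\int|f|\,w\,d\nu$ is equivalent to the norm of $L^1(m_T)$. The following assertions are equivalent. (i) $T:X(\nu)\to L^p(m_V)$ is well defined and $p$-th power factorable, i.e. there is $K$ with $\|Tf\|_{L^p(m_V)}\le K\,\||f|^{1/p}\|_{X(\nu)}^p$ for all $f\in X(\nu)$, and its extension to a linear operator $\tilde T:L^p(m_T)\to L^p(m_V)$ is $p$-regular, i.e. there is $K$ with $\|(\sum_i|\tilde Tf_i|^p)^{1/p}\|_{L^p(m_V)}\le K\|(\sum_i|f_i|^p)^{1/p}\|_{L^p(m_T)}$ for all finite families $f_1,\dots,f_n\in L^p(m_T)$. (ii) $m_T$ takes its values in $L^p(m_V)$, there is $K$ with $B_{(L^1(m_T))'}\subseteq K\,B_{(X(\nu))'}$, and there is a positively norming set of weights $W\subseteq B_{(L^1(m_T))'}$ that is conjugate to $V$ with respect to $T$. -/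

import Mathlib

open MeasureTheory Filter Topology Set
open scoped ENNReal NNReal

namespace ConjWeights

noncomputable section

/-! ### Functions modulo null sets -/

/-- The class of `|f|^r`. -/
def absPow {α : Type*} [MeasurableSpace α] {ν : Measure α} (r : ℝ) (f : α →ₘ[ν] ℝ) : α →ₘ[ν] ℝ :=
  AEEqFun.compMeasurable (fun t : ℝ => |t| ^ r) (by fun_prop) f

/-- The characteristic function of a measurable set, as a simple function. -/
def indSimple {α : Type*} [MeasurableSpace α] (A : Set α) (hA : MeasurableSet A) :
    SimpleFunc α ℝ :=
  SimpleFunc.piecewise A hA (SimpleFunc.const α 1) (SimpleFunc.const α 0)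

/-- The class of a simple function. -/
def simpleClass {α : Type*} [MeasurableSpace α] (ν : Measure α) (s : SimpleFunc α ℝ) :
    α →ₘ[ν] ℝ :=
  AEEqFun.mk s s.aestronglyMeasurable

/-- The class of the characteristic function `χ_A`. -/
def chi {α : Type*} [MeasurableSpace α] (ν : Measure α) (A : Set α) (hA : MeasurableSet A) :
    α →ₘ[ν] ℝ :=
  simpleClass ν (indSimple A hA)

/-- The measure `w dν`, for `w ∈ L¹(ν)` (used for `w ≥ 0`). -/
def weighted {α : Type*} [MeasurableSpace α] (ν : Measure α) (w : Lp ℝ 1 ν) : Measure α :=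
  ν.withDensity (fun x => ENNReal.ofReal (w x))

/-! ### Banach function spaces -/

/-- A Banach function space over `ν`: a complete normed ideal of `L⁰(ν)` that contains all simple
functions and whose norm is monotone. -/
structure BanachFunctionSpace {α : Type*} [MeasurableSpace α] (ν : Measure α) where
  carrier : Submodule ℝ (α →ₘ[ν] ℝ)
  norm : Seminorm ℝ carrier
  norm_definite : ∀ f : carrier, norm f = 0 → f = 0
  complete : ∀ u : ℕ → carrier,
    (∀ ε > 0, ∃ N, ∀ i ≥ N, ∀ j ≥ N, norm (u i - u j) < ε) →
      ∃ f : carrier, Tendsto (fun n => norm (u n - f)) atTop (𝓝 0)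
  simple_mem : ∀ s : SimpleFunc α ℝ, simpleClass ν s ∈ carrier
  ideal : ∀ (f : α →ₘ[ν] ℝ) (g : carrier), |f| ≤ |(g : α →ₘ[ν] ℝ)| →
    ∃ hf : f ∈ carrier, norm ⟨f, hf⟩ ≤ norm g

namespace BanachFunctionSpace

variable {α : Type*} [MeasurableSpace α] {ν : Measure α}

open Classical in
/-- The norm of the space, extended by `∞` to the functions outside of it. -/
def extNorm (X : BanachFunctionSpace ν) (f : α →ₘ[ν] ℝ) : ℝ≥0∞ :=
  if h : f ∈ X.carrier then ENNReal.ofReal (X.norm ⟨f, h⟩) else ∞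

/-- Order continuity: `fₙ ↓ 0` in `X` implies `‖fₙ‖ → 0`. -/
def OrderContinuous (X : BanachFunctionSpace ν) : Prop :=
  ∀ f : ℕ → X.carrier, Antitone (fun n => (f n : α →ₘ[ν] ℝ)) →
    (∀ᵐ x ∂ν, Tendsto (fun n => (f n : α →ₘ[ν] ℝ) x) atTop (𝓝 0)) →
    Tendsto (fun n => X.norm (f n)) atTop (𝓝 0)

/-- `χ_A` as an element of the space. -/
def ind (X : BanachFunctionSpace ν) (A : Set α) (hA : MeasurableSet A) : X.carrier :=
  ⟨chi ν A hA, X.simple_mem _⟩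

end BanachFunctionSpace

/-! ### Köthe duality

`F` is a set of functions in `L⁰(ν)` and `N` is a norm on it, with values in `[0, ∞]`. -/

/-- The Köthe dual of `F`: all `g ∈ L⁰(ν)` with `f g ∈ L¹(ν)` whenever `f ∈ F`. -/
def koetheDual {α : Type*} [MeasurableSpace α] (ν : Measure α) (F : Set (α →ₘ[ν] ℝ)) :
    Set (α →ₘ[ν] ℝ) :=
  {g | ∀ f ∈ F, Integrable (fun x => f x * g x) ν}

/-- The Köthe dual norm `sup {∫ f g dν : f ∈ F, N f ≤ 1}`. -/
def koetheNorm {α : Type*} [MeasurableSpace α] (ν : Measure α) (F : Set (α →ₘ[ν] ℝ))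
    (N : (α →ₘ[ν] ℝ) → ℝ≥0∞) (g : α →ₘ[ν] ℝ) : ℝ≥0∞ :=
  ⨆ (f ∈ F) (_ : N f ≤ 1), ENNReal.ofReal (∫ x, f x * g x ∂ν)

/-- The ball of radius `r` of the Köthe dual. -/
def koetheBall {α : Type*} [MeasurableSpace α] (ν : Measure α) (F : Set (α →ₘ[ν] ℝ))
    (N : (α →ₘ[ν] ℝ) → ℝ≥0∞) (r : ℝ≥0∞) : Set (α →ₘ[ν] ℝ) :=
  {g | g ∈ koetheDual ν F ∧ koetheNorm ν F N g ≤ r}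

/-! ### Integration with respect to a vector measure

Mathlib's integral against a vector measure asks for integrability with respect to the variation,
which is too restrictive: here integrability is tested on the scalar measures `⟨m, φ⟩`. -/

section VectorIntegration

variable {α : Type*} [MeasurableSpace α] {E : Type*} [NormedAddCommGroup E] [NormedSpace ℝ E]

/-- The signed measure `⟨m, φ⟩ : A ↦ φ (m A)`. -/
def scalarMeasure (m : VectorMeasure α E) (φ : StrongDual ℝ E) : SignedMeasure α :=
  m.mapRange φ.toLinearMap.toAddMonoidHom φ.continuous

/-- The integral of `f` over `A` with respect to a signed measure. -/
def signedIntegral (l : SignedMeasure α) (A : Set α) (f : α → ℝ) : ℝ :=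
  (∫ x in A, f x ∂l.toJordanDecomposition.posPart) -
    ∫ x in A, f x ∂l.toJordanDecomposition.negPart

/-- `f ∈ L¹(m)`: `f` is measurable, integrable with respect to every `⟨m, φ⟩`, and for each
measurable `A` there is a vector `∫_A f dm` in `E`. -/
def MemL1 (m : VectorMeasure α E) (f : α → ℝ) : Prop :=
  Measurable f ∧
  (∀ φ : StrongDual ℝ E, Integrable f (scalarMeasure m φ).totalVariation) ∧
  ∀ A, MeasurableSet A →
    ∃ y : E, ∀ φ : StrongDual ℝ E, φ y = signedIntegral (scalarMeasure m φ) A f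

/-- `‖f‖_{L¹(m)} = sup {∫ |f| d|⟨m, φ⟩| : ‖φ‖ ≤ 1}`. -/
def l1Norm (m : VectorMeasure α E) (f : α → ℝ) : ℝ≥0∞ :=
  ⨆ (φ : StrongDual ℝ E) (_ : ‖φ‖ ≤ 1), ∫⁻ x, ‖f x‖ₑ ∂(scalarMeasure m φ).totalVariation

/-- `f ∈ L^p(m)`: `f` is measurable and `|f|^p ∈ L¹(m)`. -/
def MemLpVec (m : VectorMeasure α E) (p : ℝ≥0∞) (f : α → ℝ) : Prop :=
  Measurable f ∧ MemL1 m (fun x => |f x| ^ p.toReal)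

/-- `‖f‖_{L^p(m)} = ‖ |f|^p ‖_{L¹(m)}^{1/p}`. -/
def lpNormVec (m : VectorMeasure α E) (p : ℝ≥0∞) (f : α → ℝ) : ℝ≥0∞ :=
  l1Norm m (fun x => |f x| ^ p.toReal) ^ (1 / p.toReal)

/-- Equality of functions outside of an `m`-null set. -/
def EqModNull (m : VectorMeasure α E) (f g : α → ℝ) : Prop :=
  ∃ N, MeasurableSet N ∧ (∀ B ⊆ N, MeasurableSet B → m B = 0) ∧ ∀ x ∉ N, f x = g x

/-- The elements of `L⁰(ν)` that are in `L¹(m)`. -/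
def L1Set (ν : Measure α) (m : VectorMeasure α E) : Set (α →ₘ[ν] ℝ) := {f | MemL1 m f}

end VectorIntegration

/-! ### The vector measure of a set of weights -/

section Weights

variable {Ω : Type*} [MeasurableSpace Ω] {μ : Measure Ω}

/-- Relative compactness in `L¹(μ)` for the weak topology. -/
def RelWeaklyCompact (V : Set (Lp ℝ 1 μ)) : Prop :=
  IsCompact (closure (toWeakSpace ℝ (Lp ℝ 1 μ) '' V))

/-- `v ↦ ∫_A v dμ` as a continuous functional on `L¹(μ)`. -/
def setIntegralCLM (μ : Measure Ω) (A : Set Ω) : StrongDual ℝ (Lp ℝ 1 μ) where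
  toFun v := ∫ x in A, v x ∂μ
  map_add' v w := by
    rw [← integral_add (L1.integrable_coeFn v).integrableOn (L1.integrable_coeFn w).integrableOn]
    exact integral_congr_ae (ae_restrict_of_ae (Lp.coeFn_add v w))
  map_smul' c v := by
    rw [RingHom.id_apply, ← integral_smul]
    exact integral_congr_ae (ae_restrict_of_ae (Lp.coeFn_smul c v))
  cont := continuous_setIntegral A

theorem continuous_weak_setIntegral (A : Set Ω) :
    Continuous fun v : WeakSpace ℝ (Lp ℝ 1 μ) =>
      setIntegralCLM μ A ((toWeakSpace ℝ (Lp ℝ 1 μ)).symm v) :=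
  WeakBilin.eval_continuous _ (setIntegralCLM μ A)

theorem bddAbove_setIntegral {V : Set (Lp ℝ 1 μ)} (hV : RelWeaklyCompact V) (A : Set Ω) :
    BddAbove (Set.range fun v : V => ‖∫ x in A, (v : Lp ℝ 1 μ) x ∂μ‖) := by
  obtain ⟨C, hC⟩ := hV.exists_bound_of_continuousOn
    (continuous_weak_setIntegral (μ := μ) A).continuousOn
  refine ⟨C, ?_⟩
  rintro _ ⟨v, rfl⟩
  exact hC _ (subset_closure ⟨v, v.2, rfl⟩)

/-- `(∫_A v dμ)_{v ∈ V} ∈ ℓ^∞(V)`. -/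
def weightVec {V : Set (Lp ℝ 1 μ)} (hV : RelWeaklyCompact V) (A : Set Ω) :
    lp (fun _ : V => ℝ) ∞ :=
  ⟨fun v => ∫ x in A, (v : Lp ℝ 1 μ) x ∂μ, memℓp_infty (bddAbove_setIntegral hV A)⟩

theorem setIntegral_nonneg_of_mem_closure {V : Set (Lp ℝ 1 μ)} (hV0 : ∀ v ∈ V, 0 ≤ v)
    (A : Set Ω) {v : WeakSpace ℝ (Lp ℝ 1 μ)}
    (hv : v ∈ closure (toWeakSpace ℝ (Lp ℝ 1 μ) '' V)) :
    0 ≤ setIntegralCLM μ A ((toWeakSpace ℝ (Lp ℝ 1 μ)).symm v) := by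
  refine closure_minimal (t := {v : WeakSpace ℝ (Lp ℝ 1 μ) |
    0 ≤ setIntegralCLM μ A ((toWeakSpace ℝ (Lp ℝ 1 μ)).symm v)}) ?_
    (isClosed_le continuous_const (continuous_weak_setIntegral A)) hv
  rintro _ ⟨w, hw, rfl⟩
  exact integral_nonneg_of_ae (ae_restrict_of_ae ((Lp.coeFn_nonneg w).2 (hV0 w hw)))

theorem hasSum_weightVec {V : Set (Lp ℝ 1 μ)} (hV0 : ∀ v ∈ V, 0 ≤ v) (hV : RelWeaklyCompact V)
    {A : ℕ → Set Ω} (hA : ∀ i, MeasurableSet (A i)) (hd : Pairwise (Function.onFun Disjoint A)) :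
    HasSum (fun i => weightVec hV (A i)) (weightVec hV (⋃ i, A i)) := by
  set K := closure (toWeakSpace ℝ (Lp ℝ 1 μ) '' V)
  set I : Set Ω → WeakSpace ℝ (Lp ℝ 1 μ) → ℝ :=
    fun B v => setIntegralCLM μ B ((toWeakSpace ℝ (Lp ℝ 1 μ)).symm v) with hI
  have hunif : TendstoUniformlyOn (fun (s : Finset ℕ) v => ∑ i ∈ s, I (A i) v)
      (I (⋃ i, A i)) atTop K := by
    refine Monotone.tendstoUniformlyOn_of_forall_tendsto hV ?_ ?_ ?_ ?_
    · exact fun s => (continuous_finsetSum s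
        fun i _ => continuous_weak_setIntegral (A i)).continuousOn
    · intro v hv s t hst
      exact Finset.sum_le_sum_of_subset_of_nonneg hst
        fun i _ _ => setIntegral_nonneg_of_mem_closure hV0 (A i) hv
    · exact (continuous_weak_setIntegral _).continuousOn
    · intro v _
      exact hasSum_integral_iUnion hA hd (L1.integrable_coeFn _).integrableOn
  rw [HasSum, SummationFilter.unconditional_filter, Metric.tendsto_atTop]
  intro ε hε
  have h := (Metric.tendstoUniformlyOn_iff.1 hunif) (ε / 2) (half_pos hε)
  obtain ⟨s₀, hs₀⟩ := eventually_atTop.1 h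
  refine ⟨s₀, fun s hs => ?_⟩
  rw [dist_comm, dist_eq_norm]
  refine lt_of_le_of_lt (lp.norm_le_of_forall_le (half_pos hε).le fun v => ?_) (half_lt_self hε)
  have hv := hs₀ s hs (toWeakSpace ℝ (Lp ℝ 1 μ) v) (subset_closure ⟨v, v.2, rfl⟩)
  rw [Real.dist_eq] at hv
  refine le_of_eq_of_le ?_ hv.le
  rw [lp.coeFn_sub, Pi.sub_apply, lp.coeFn_sum, Finset.sum_apply, Real.norm_eq_abs]
  rfl

open Classical in
/-- The vector measure `m_V : A ↦ (∫_A v dμ)_{v ∈ V} ∈ ℓ^∞(V)`. -/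
def weightMeasure (V : Set (Lp ℝ 1 μ)) (hV0 : ∀ v ∈ V, 0 ≤ v) (hV : RelWeaklyCompact V) :
    VectorMeasure Ω (lp (fun _ : V => ℝ) ∞) where
  measureOf' A := if MeasurableSet A then weightVec hV A else 0
  empty' := by
    rw [if_pos MeasurableSet.empty]
    ext v
    simp [weightVec]
  not_measurable' A hA := if_neg hA
  m_iUnion' A hA hd := by
    simp only [hA, MeasurableSet.iUnion hA, if_true]
    exact hasSum_weightVec hV0 hV hA hd

end Weights

/-! ### Operators into all the weighted spaces `L^p(v dμ)`, and their vector measures -/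

section Operators

variable {Ω₁ Ω₂ : Type*} [MeasurableSpace Ω₁] [MeasurableSpace Ω₂] {ν : Measure Ω₁}
  {μ : Measure Ω₂} {X : BanachFunctionSpace ν}

/-- `T` is bounded from `X` to `L^p(v dμ)`, uniformly over `v ∈ V`. -/
def UniformlyBounded (p : ℝ≥0∞) (V : Set (Lp ℝ 1 μ)) (T : X.carrier →ₗ[ℝ] (Ω₂ →ₘ[μ] ℝ)) : Prop :=
  ∃ C : ℝ≥0, ∀ v ∈ V, ∀ f : X.carrier,
    eLpNorm (T f) p (weighted μ v) ≤ C * ENNReal.ofReal (X.norm f)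

/-- The Banach space of bounded families `(y_v)_{v ∈ V}`, `y_v ∈ L^p(v dμ)`, with the norm
`sup_v ‖y_v‖`. Since `‖h‖_{L^p(m_V)} = sup_v ‖h‖_{L^p(v dμ)}`, the space `L^p(m_V)` is a closed
subspace of it, each `h` being identified with the family of its classes. -/
abbrev RangeSpace (p : ℝ≥0∞) [Fact (1 ≤ p)] (V : Set (Lp ℝ 1 μ)) : Type _ :=
  lp (fun v : V => Lp ℝ p (weighted μ v)) ∞

theorem UniformlyBounded.memLp {p : ℝ≥0∞} {V : Set (Lp ℝ 1 μ)}
    {T : X.carrier →ₗ[ℝ] (Ω₂ →ₘ[μ] ℝ)} (hT : UniformlyBounded p V T) (f : X.carrier) (v : V) :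
    MemLp (T f) p (weighted μ v) := by
  obtain ⟨C, hC⟩ := hT
  refine ⟨(T f).aestronglyMeasurable.mono_ac (withDensity_absolutelyContinuous _ _), ?_⟩
  exact (hC v v.2 f).trans_lt (ENNReal.mul_lt_top ENNReal.coe_lt_top ENNReal.ofReal_lt_top)

/-- `T f` as a bounded family of elements of the spaces `L^p(v dμ)`. -/
def opVec {p : ℝ≥0∞} [Fact (1 ≤ p)] {V : Set (Lp ℝ 1 μ)}
    {T : X.carrier →ₗ[ℝ] (Ω₂ →ₘ[μ] ℝ)} (hT : UniformlyBounded p V T) (f : X.carrier) :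
    RangeSpace p V :=
  ⟨fun v => (hT.memLp f v).toLp _, memℓp_infty (by
    obtain ⟨C, hC⟩ := id hT
    refine ⟨C * X.norm f, ?_⟩
    rintro _ ⟨v, rfl⟩
    simp only [Lp.norm_toLp]
    refine ENNReal.toReal_le_of_le_ofReal (by positivity) ((hC v v.2 f).trans_eq ?_)
    rw [ENNReal.ofReal_mul C.coe_nonneg, ENNReal.ofReal_coe_nnreal])⟩

theorem opVec_add {p : ℝ≥0∞} [Fact (1 ≤ p)] {V : Set (Lp ℝ 1 μ)}
    {T : X.carrier →ₗ[ℝ] (Ω₂ →ₘ[μ] ℝ)} (hT : UniformlyBounded p V T) (f g : X.carrier) :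
    opVec hT (f + g) = opVec hT f + opVec hT g := by
  ext1
  funext v
  change (hT.memLp (f + g) v).toLp _ = (hT.memLp f v).toLp _ + (hT.memLp g v).toLp _
  rw [← MemLp.toLp_add, MemLp.toLp_eq_toLp_iff, map_add]
  exact (withDensity_absolutelyContinuous _ _).ae_le (AEEqFun.coeFn_add _ _)

theorem norm_opVec_le {p : ℝ≥0∞} [Fact (1 ≤ p)] {V : Set (Lp ℝ 1 μ)}
    {T : X.carrier →ₗ[ℝ] (Ω₂ →ₘ[μ] ℝ)} (hT : UniformlyBounded p V T) :
    ∃ C : ℝ≥0, ∀ f, ‖opVec hT f‖ ≤ C * X.norm f := by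
  obtain ⟨C, hC⟩ := id hT
  refine ⟨C, fun f => lp.norm_le_of_forall_le (by positivity) fun v => ?_⟩
  change ‖(hT.memLp f v).toLp _‖ ≤ _
  rw [Lp.norm_toLp]
  refine ENNReal.toReal_le_of_le_ofReal (by positivity) ((hC v v.2 f).trans_eq ?_)
  rw [ENNReal.ofReal_mul C.coe_nonneg, ENNReal.ofReal_coe_nnreal]

theorem chi_coe {α : Type*} [MeasurableSpace α] (ν : Measure α) (A : Set α)
    (hA : MeasurableSet A) : (chi ν A hA : α → ℝ) =ᵐ[ν] A.indicator fun _ => 1 := by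
  refine (AEEqFun.coeFn_mk _ _).trans (Eventually.of_forall fun x => ?_)
  by_cases hx : x ∈ A <;> simp [indSimple, hx]

theorem ind_empty : X.ind ∅ MeasurableSet.empty = 0 := by
  apply Subtype.ext
  refine AEEqFun.ext ((chi_coe ν _ _).trans ?_)
  filter_upwards [AEEqFun.coeFn_zero (μ := ν) (β := ℝ) (α := Ω₁)] with x hx
  simp [hx]

theorem ind_union {A B : Set Ω₁} (hA : MeasurableSet A) (hB : MeasurableSet B)
    (hd : Disjoint A B) : X.ind (A ∪ B) (hA.union hB) = X.ind A hA + X.ind B hB := by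
  apply Subtype.ext
  refine AEEqFun.ext ((chi_coe ν _ _).trans ?_)
  filter_upwards [AEEqFun.coeFn_add (chi ν A hA) (chi ν B hB), chi_coe ν A hA, chi_coe ν B hB]
    with x h1 h2 h3
  refine Eq.trans ?_ h1.symm
  rw [Pi.add_apply, h2, h3, indicator_union_of_disjoint hd]

theorem chi_mono {A B : Set Ω₁} (hA : MeasurableSet A) (hB : MeasurableSet B) (h : A ⊆ B) :
    chi ν A hA ≤ chi ν B hB := by
  rw [← AEEqFun.coeFn_le]
  filter_upwards [chi_coe ν A hA, chi_coe ν B hB] with x h2 h3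
  rw [h2, h3]
  exact indicator_le_indicator_of_subset h (fun _ => zero_le_one) x

theorem norm_ind_mono {A B : Set Ω₁} (hA : MeasurableSet A) (hB : MeasurableSet B) (h : A ⊆ B) :
    X.norm (X.ind A hA) ≤ X.norm (X.ind B hB) := by
  have h0 : ∀ {C : Set Ω₁} (hC : MeasurableSet C), |chi ν C hC| = chi ν C hC := by
    intro C hC
    refine AEEqFun.ext ?_
    filter_upwards [AEEqFun.coeFn_abs (chi ν C hC), chi_coe ν C hC] with x h1 h2
    rw [h1, h2, abs_of_nonneg (indicator_nonneg (fun _ _ => zero_le_one) x)]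
  obtain ⟨_, h'⟩ := X.ideal (chi ν A hA) (X.ind B hB) (by
    rw [h0]
    exact (chi_mono hA hB h).trans_eq (h0 hB).symm)
  exact h'

theorem opVec_ind_biUnion {p : ℝ≥0∞} [Fact (1 ≤ p)] {V : Set (Lp ℝ 1 μ)}
    {T : X.carrier →ₗ[ℝ] (Ω₂ →ₘ[μ] ℝ)} (hT : UniformlyBounded p V T) {A : ℕ → Set Ω₁}
    (hA : ∀ i, MeasurableSet (A i)) (hd : Pairwise (Function.onFun Disjoint A)) (s : Finset ℕ) :
    opVec hT (X.ind (⋃ i ∈ s, A i) (s.measurableSet_biUnion fun i _ => hA i)) =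
      ∑ i ∈ s, opVec hT (X.ind (A i) (hA i)) := by
  induction s using Finset.induction_on with
  | empty =>
    have h : opVec hT (0 : X.carrier) = 0 := by
      have := opVec_add hT 0 0
      simpa using this
    simp [ind_empty, h]
  | insert i s hi ih =>
    have hdis : Disjoint (A i) (⋃ j ∈ s, A j) := by
      refine disjoint_iUnion₂_right.2 fun j hj => hd ?_
      rintro rfl
      exact hi hj
    rw [Finset.sum_insert hi, ← ih, ← opVec_add, ← ind_union _ _ hdis]
    congr 2
    simp

theorem hasSum_opVec_ind {p : ℝ≥0∞} [Fact (1 ≤ p)] {V : Set (Lp ℝ 1 μ)}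
    {T : X.carrier →ₗ[ℝ] (Ω₂ →ₘ[μ] ℝ)} (hX : X.OrderContinuous) (hT : UniformlyBounded p V T)
    {A : ℕ → Set Ω₁} (hA : ∀ i, MeasurableSet (A i))
    (hd : Pairwise (Function.onFun Disjoint A)) :
    HasSum (fun i => opVec hT (X.ind (A i) (hA i)))
      (opVec hT (X.ind (⋃ i, A i) (MeasurableSet.iUnion hA))) := by
  obtain ⟨C, hC⟩ := norm_opVec_le hT
  have hB : ∀ n, MeasurableSet (⋃ i ≥ n, A i) := fun n =>
    MeasurableSet.iUnion fun i => MeasurableSet.iUnion fun _ => hA i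
  have hlim : Tendsto (fun n => C * X.norm (X.ind (⋃ i ≥ n, A i) (hB n))) atTop (𝓝 0) := by
    have := hX (fun n => X.ind (⋃ i ≥ n, A i) (hB n))
      (fun m n hmn => chi_mono (hB n) (hB m)
        (iUnion_mono fun i => iUnion_mono' fun h => ⟨hmn.trans h, subset_rfl⟩)) ?_
    · simpa using this.const_mul (C : ℝ)
    · have hae : ∀ᵐ x ∂ν, ∀ n, chi ν (⋃ i ≥ n, A i) (hB n) x =
          (⋃ i ≥ n, A i).indicator (fun _ => 1) x := ae_all_iff.2 fun n => chi_coe ν _ (hB n)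
      filter_upwards [hae] with x hx
      have hex : ∃ N, ∀ i ≥ N, x ∉ A i := by
        by_cases h : ∃ j, x ∈ A j
        · obtain ⟨j, hj⟩ := h
          refine ⟨j + 1, fun i hi hxi => ?_⟩
          exact disjoint_left.1 (hd (show i ≠ j by lia)) hxi hj
        · exact ⟨0, fun i _ hxi => h ⟨i, hxi⟩⟩
      obtain ⟨N, hN⟩ := hex
      refine tendsto_const_nhds.congr' ?_
      filter_upwards [eventually_ge_atTop N] with n hn
      refine ((hx n).trans (indicator_of_notMem ?_ _)).symm
      simp only [mem_iUnion, not_exists]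
      exact fun i hi => hN i (hn.trans hi)
  rw [HasSum, SummationFilter.unconditional_filter, Metric.tendsto_atTop]
  intro ε hε
  obtain ⟨n, hn⟩ := ((tendsto_order.1 hlim).2 ε hε).exists
  refine ⟨Finset.range n, fun s hs => ?_⟩
  have hms : MeasurableSet (⋃ i ∈ s, A i) := s.measurableSet_biUnion fun i _ => hA i
  have hmd := (MeasurableSet.iUnion hA).diff hms
  have hsplit : X.ind (⋃ i, A i) (MeasurableSet.iUnion hA) =
      X.ind (⋃ i ∈ s, A i) hms + X.ind ((⋃ i, A i) \ ⋃ i ∈ s, A i) hmd := by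
    rw [← ind_union hms hmd disjoint_sdiff_right]
    congr 1
    rw [union_sdiff_cancel]
    exact iUnion₂_subset fun i _ => subset_iUnion A i
  rw [dist_comm, dist_eq_norm, hsplit, opVec_add, opVec_ind_biUnion hT hA hd, add_sub_cancel_left]
  refine lt_of_le_of_lt ((hC _).trans ?_) hn
  refine mul_le_mul_of_nonneg_left (norm_ind_mono hmd (hB n) ?_) C.coe_nonneg
  rintro x ⟨hx, hxs⟩
  obtain ⟨i, hi⟩ := mem_iUnion.1 hx
  refine mem_iUnion₂.2 ⟨i, ?_, hi⟩
  by_contra hlt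
  exact hxs (mem_iUnion₂.2 ⟨i, hs (Finset.mem_range.2 (not_le.1 hlt)), hi⟩)

open Classical in
/-- The vector measure `m_T : A ↦ T χ_A`. If `T χ_A ∈ L^p(m_V)` for all `A`, then it takes its
values in the closed subspace `L^p(m_V)` of `RangeSpace p V`; neither `L¹(m_T)` nor its norm
depends on which of the two spaces is taken as the range space (Hahn-Banach). -/
def opMeasure {p : ℝ≥0∞} [Fact (1 ≤ p)] {V : Set (Lp ℝ 1 μ)} {T : X.carrier →ₗ[ℝ] (Ω₂ →ₘ[μ] ℝ)}
    (hX : X.OrderContinuous) (hT : UniformlyBounded p V T) :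
    VectorMeasure Ω₁ (RangeSpace p V) where
  measureOf' A := if hA : MeasurableSet A then opVec hT (X.ind A hA) else 0
  empty' := by
    rw [dif_pos MeasurableSet.empty]
    simpa using opVec_ind_biUnion hT (A := fun _ => ∅) (fun _ => MeasurableSet.empty)
      (fun _ _ _ => disjoint_empty _) ∅
  not_measurable' A hA := dif_neg hA
  m_iUnion' A hA hd := by
    simp only [hA, MeasurableSet.iUnion hA, dif_pos]
    exact hasSum_opVec_ind hX hT hA hd

/-! ### The notions of the theorem -/

/-- `T : X → L^p(m)` is well defined. -/
def WellDefinedInto {E : Type*} [NormedAddCommGroup E] [NormedSpace ℝ E]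
    (m : VectorMeasure Ω₂ E) (p : ℝ≥0∞) (T : X.carrier →ₗ[ℝ] (Ω₂ →ₘ[μ] ℝ)) : Prop :=
  ∀ f : X.carrier, MemLpVec m p (T f)

/-- `T : X → L^p(m)` is `p`-th power factorable:
`‖T f‖_{L^p(m)} ≤ K ‖ |f|^{1/p} ‖_X ^ p` for every `f ∈ X`. -/
def PthPowerFactorable {E : Type*} [NormedAddCommGroup E] [NormedSpace ℝ E]
    (m : VectorMeasure Ω₂ E) (p : ℝ≥0∞) (T : X.carrier →ₗ[ℝ] (Ω₂ →ₘ[μ] ℝ)) : Prop :=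
  ∃ K : ℝ≥0, ∀ f : X.carrier,
    lpNormVec m p (T f) ≤
      K * X.extNorm (absPow (1 / p.toReal) (f : Ω₁ →ₘ[ν] ℝ)) ^ p.toReal

/-- `S` is a linear operator `L^p(m₁) → L^p(m₂)` (up to equality outside of `m₂`-null sets) that
agrees with `T` on `X ∩ L^p(m₁)`. (If `m₁` is the measure of `T`, then `X ⊆ L^p(m₁)` is a
consequence of `p`-th power factorability.) -/
structure IsExtension {E₁ E₂ : Type*} [NormedAddCommGroup E₁] [NormedSpace ℝ E₁]
    [NormedAddCommGroup E₂] [NormedSpace ℝ E₂] (m₁ : VectorMeasure Ω₁ E₁)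
    (m₂ : VectorMeasure Ω₂ E₂) (p : ℝ≥0∞) (T : X.carrier →ₗ[ℝ] (Ω₂ →ₘ[μ] ℝ))
    (S : (Ω₁ →ₘ[ν] ℝ) → (Ω₂ →ₘ[μ] ℝ)) : Prop where
  mapsTo : ∀ f : Ω₁ →ₘ[ν] ℝ, MemLpVec m₁ p f → MemLpVec m₂ p (S f)
  add : ∀ f g : Ω₁ →ₘ[ν] ℝ, MemLpVec m₁ p f → MemLpVec m₁ p g →
    EqModNull m₂ (S (f + g)) (S f + S g : Ω₂ →ₘ[μ] ℝ)
  smul : ∀ (c : ℝ) (f : Ω₁ →ₘ[ν] ℝ), MemLpVec m₁ p f →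
    EqModNull m₂ (S (c • f)) (c • S f : Ω₂ →ₘ[μ] ℝ)
  extends_op : ∀ f : X.carrier, MemLpVec m₁ p (f : Ω₁ →ₘ[ν] ℝ) →
    EqModNull m₂ (S (f : Ω₁ →ₘ[ν] ℝ)) (T f)

/-- `S : L^p(m₁) → L^p(m₂)` is `p`-regular:
`‖(∑ |S fᵢ|^p)^{1/p}‖ ≤ K ‖(∑ |fᵢ|^p)^{1/p}‖` for all finite families in `L^p(m₁)`
(the case of one function is the continuity of `S`). -/
def PRegular {E₁ E₂ : Type*} [NormedAddCommGroup E₁] [NormedSpace ℝ E₁]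
    [NormedAddCommGroup E₂] [NormedSpace ℝ E₂] (m₁ : VectorMeasure Ω₁ E₁)
    (m₂ : VectorMeasure Ω₂ E₂) (p : ℝ≥0∞) (S : (Ω₁ →ₘ[ν] ℝ) → (Ω₂ →ₘ[μ] ℝ)) : Prop :=
  ∃ K : ℝ≥0, ∀ (n : ℕ) (f : Fin n → (Ω₁ →ₘ[ν] ℝ)), (∀ i, MemLpVec m₁ p (f i)) →
    lpNormVec m₂ p (fun y => (∑ i, |S (f i) y| ^ p.toReal) ^ (1 / p.toReal)) ≤
      K * lpNormVec m₁ p (fun x => (∑ i, |f i x| ^ p.toReal) ^ (1 / p.toReal))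

/-- `W ⊆ L¹(ν)₊` is a conjugate family of weights for `V` with respect to `T`: the inclusions
`X → L^p(w dν)` are bounded uniformly over `w ∈ W`, and with some `C` independent of `v`, for every
`v ∈ V` there is `w ∈ W` such that `T` is continuous from `L^p(w dν)` to `L^p(v dμ)` with norm at
most `C` (that is, it is induced by a bounded operator between these two spaces; as `X` contains
the simple functions, this operator is unique). -/
def IsConjugate (p : ℝ≥0∞) [Fact (1 ≤ p)] (V : Set (Lp ℝ 1 μ)) (W : Set (Lp ℝ 1 ν))
    (T : X.carrier →ₗ[ℝ] (Ω₂ →ₘ[μ] ℝ)) : Prop :=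
  (∀ w ∈ W, 0 ≤ w) ∧
  (∃ D : ℝ≥0, ∀ w ∈ W, ∀ f : X.carrier,
    eLpNorm (f : Ω₁ →ₘ[ν] ℝ) p (weighted ν w) ≤ D * ENNReal.ofReal (X.norm f)) ∧
  ∃ C : ℝ≥0, ∀ v ∈ V, ∃ w ∈ W,
    ∃ S : Lp ℝ p (weighted ν w) →L[ℝ] Lp ℝ p (weighted μ v), ‖S‖ ≤ C ∧
      ∀ (f : X.carrier) (g : Lp ℝ p (weighted ν w)), g =ᵐ[weighted ν w] (f : Ω₁ →ₘ[ν] ℝ) →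
        S g =ᵐ[weighted μ v] T f

/-- `W`, a set of non-negative weights in the unit ball of the Köthe dual of `L¹(m)`, is positively
norming: `f ↦ sup_{w ∈ W} ∫ |f| w dν` is equivalent to the norm of `L¹(m)`. -/
def PositivelyNorming {E : Type*} [NormedAddCommGroup E] [NormedSpace ℝ E]
    (m : VectorMeasure Ω₁ E) (W : Set (Lp ℝ 1 ν)) : Prop :=
  (∀ w ∈ W, 0 ≤ w ∧ (w : Ω₁ →ₘ[ν] ℝ) ∈ koetheBall ν (L1Set ν m) (fun f => l1Norm m f) 1) ∧
  ∃ c C : ℝ≥0, 0 < c ∧ ∀ f : Ω₁ →ₘ[ν] ℝ, MemL1 m f →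
    c * l1Norm m f ≤ (⨆ w ∈ W, ∫⁻ x, ENNReal.ofReal (|f x| * w x) ∂ν) ∧
    (⨆ w ∈ W, ∫⁻ x, ENNReal.ofReal (|f x| * w x) ∂ν) ≤ C * l1Norm m f

end Operators

end

end ConjWeights

namespace ConjWeights

section SignedIntegral

variable {α : Type*} [MeasurableSpace α]

theorem signedMeasure_apply (l : SignedMeasure α) {A : Set α} (hA : MeasurableSet A) :
    l A = l.toJordanDecomposition.posPart.real A - l.toJordanDecomposition.negPart.real A :=
  l.apply_eq_posPart_real_sub_negPart_real hA

theorem integrable_posPart {l : SignedMeasure α} {f : α → ℝ} (hf : Integrable f l.totalVariation) :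
    Integrable f l.toJordanDecomposition.posPart :=
  hf.mono_measure (Measure.le_add_right le_rfl)

theorem integrable_negPart {l : SignedMeasure α} {f : α → ℝ} (hf : Integrable f l.totalVariation) :
    Integrable f l.toJordanDecomposition.negPart :=
  hf.mono_measure (Measure.le_add_left le_rfl)

theorem signedIntegral_add {l : SignedMeasure α} {f g : α → ℝ} (A : Set α)
    (hf : Integrable f l.totalVariation) (hg : Integrable g l.totalVariation) :
    signedIntegral l A (fun x => f x + g x) = signedIntegral l A f + signedIntegral l A g := by
  unfold signedIntegral
  beta_reduce
  rw [integral_add (integrable_posPart hf).integrableOn (integrable_posPart hg).integrableOn,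
    integral_add (integrable_negPart hf).integrableOn (integrable_negPart hg).integrableOn]
  ring

theorem signedIntegral_const_mul (l : SignedMeasure α) (A : Set α) (c : ℝ) (f : α → ℝ) :
    signedIntegral l A (fun x => c * f x) = c * signedIntegral l A f := by
  unfold signedIntegral
  rw [integral_const_mul, integral_const_mul]
  ring

theorem signedIntegral_indicator (l : SignedMeasure α) (A : Set α) {B : Set α}
    (hB : MeasurableSet B) (f : α → ℝ) :
    signedIntegral l A (B.indicator f) = signedIntegral l (A ∩ B) f := by
  unfold signedIntegral
  rw [setIntegral_indicator hB, setIntegral_indicator hB]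

theorem signedIntegral_const (l : SignedMeasure α) {A : Set α} (hA : MeasurableSet A) (c : ℝ) :
    signedIntegral l A (fun _ => c) = c * l A := by
  unfold signedIntegral
  rw [setIntegral_const, setIntegral_const, signedMeasure_apply l hA, smul_eq_mul, smul_eq_mul]
  ring

theorem signedIntegral_congr {l : SignedMeasure α} {f g : α → ℝ} (A : Set α)
    (h : f =ᵐ[l.totalVariation] g) : signedIntegral l A f = signedIntegral l A g := by
  obtain ⟨h1, h2⟩ := ae_add_measure_iff.1 h
  unfold signedIntegral
  rw [integral_congr_ae (ae_restrict_of_ae h1), integral_congr_ae (ae_restrict_of_ae h2)]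

theorem enorm_signedIntegral_le (l : SignedMeasure α) (A : Set α) (f : α → ℝ) :
    ‖signedIntegral l A f‖ₑ ≤ ∫⁻ x, ‖f x‖ₑ ∂l.totalVariation := by
  unfold signedIntegral SignedMeasure.totalVariation
  rw [lintegral_add_measure]
  refine (enorm_sub_le).trans (add_le_add ?_ ?_) <;>
  exact (enorm_integral_le_lintegral_enorm _).trans (setLIntegral_le_lintegral _ _)

/-- Integrating `±f` against a signed measure gives the integral of `|f|` against its variation,
for a suitable measurable choice of signs. -/
theorem exists_signedIntegral_signs (l : SignedMeasure α) {f : α → ℝ} (hf : Measurable f)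
    (hfi : Integrable f l.totalVariation) :
    ∃ Q, MeasurableSet Q ∧ ∫⁻ x, ‖f x‖ₑ ∂l.totalVariation =
      ENNReal.ofReal (signedIntegral l univ fun x => Q.indicator f x - Qᶜ.indicator f x) := by
  obtain ⟨S, hS, hpos, hneg⟩ := l.toJordanDecomposition.mutuallySingular
  have hm : MeasurableSet {x | 0 ≤ f x} := measurableSet_le measurable_const hf
  set Q : Set α := (Sᶜ ∩ {x | 0 ≤ f x}) ∪ (S ∩ {x | 0 ≤ f x}ᶜ) with hQ
  refine ⟨Q, (hS.compl.inter hm).union (hS.inter hm.compl), ?_⟩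
  unfold signedIntegral
  rw [Measure.restrict_univ, Measure.restrict_univ]
  have h1 : ∫ x, (Q.indicator f x - Qᶜ.indicator f x)
      ∂l.toJordanDecomposition.posPart = ∫ x, ‖f x‖ ∂l.toJordanDecomposition.posPart := by
    refine integral_congr_ae ?_
    filter_upwards [measure_eq_zero_iff_ae_notMem.1 hpos] with x hx
    by_cases h : 0 ≤ f x
    · simp [hQ, hx, h, abs_of_nonneg]
    · simp [hQ, hx, h, abs_of_neg (not_le.1 h)]
  have h2 : ∫ x, (Q.indicator f x - Qᶜ.indicator f x)
      ∂l.toJordanDecomposition.negPart = ∫ x, -‖f x‖ ∂l.toJordanDecomposition.negPart := by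
    refine integral_congr_ae ?_
    filter_upwards [measure_eq_zero_iff_ae_notMem.1 hneg] with x hx
    have hx : x ∈ S := by simpa using hx
    by_cases h : 0 ≤ f x
    · simp [hQ, hx, h, abs_of_nonneg]
    · simp [hQ, hx, h, abs_of_neg (not_le.1 h)]
  rw [h1, h2, integral_neg, sub_neg_eq_add, ← integral_add_measure (integrable_posPart hfi).norm (integrable_negPart hfi).norm,
    ← ofReal_integral_norm_eq_lintegral_enorm hfi]
  rfl

theorem tendsto_signedIntegral {l : SignedMeasure α} {f b : α → ℝ} {s : ℕ → α → ℝ} (A : Set α)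
    (hb : Integrable b l.totalVariation) (hs : ∀ n, Measurable (s n))
    (hsb : ∀ n x, |s n x| ≤ b x) (hlim : ∀ x, Tendsto (fun n => s n x) atTop (𝓝 (f x))) :
    Tendsto (fun n => signedIntegral l A (s n)) atTop (𝓝 (signedIntegral l A f)) := by
  unfold signedIntegral
  refine Tendsto.sub ?_ ?_
  · exact tendsto_integral_of_dominated_convergence b
      (fun n => (hs n).aestronglyMeasurable) (integrable_posPart hb).integrableOn
      (fun n => Eventually.of_forall fun x => hsb n x) (Eventually.of_forall hlim)
  · exact tendsto_integral_of_dominated_convergence b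
      (fun n => (hs n).aestronglyMeasurable) (integrable_negPart hb).integrableOn
      (fun n => Eventually.of_forall fun x => hsb n x) (Eventually.of_forall hlim)

end SignedIntegral

section Approximation

variable {α : Type*} [MeasurableSpace α]

theorem lintegral_enorm_le_of_simpleFunc (κ : Measure α) {f : α → ℝ} {B : ℝ≥0∞}
    (h : ∀ s : SimpleFunc α ℝ, (∀ x, 0 ≤ s x) → (∀ x, s x ≤ |f x|) → ∫⁻ x, ‖s x‖ₑ ∂κ ≤ B) :
    ∫⁻ x, ‖f x‖ₑ ∂κ ≤ B := by
  rw [lintegral_eq_nnreal]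
  refine iSup₂_le fun φ hφ => ?_
  rw [← SimpleFunc.lintegral_eq_lintegral]
  refine le_of_eq_of_le (lintegral_congr fun x => ?_)
    (h (φ.map NNReal.toReal) (fun x => (φ x).2) fun x => ?_)
  · simp
  · have := hφ x
    rw [← ofReal_norm, ENNReal.le_ofReal_iff_toReal_le (by simp) (norm_nonneg _)] at this
    simpa using this

theorem exists_simpleFunc_monotone_tendsto {f : α → ℝ} (hf : Measurable f) (h0 : ∀ x, 0 ≤ f x) :
    ∃ s : ℕ → SimpleFunc α ℝ, (∀ n x, 0 ≤ s n x) ∧ (∀ n x, s n x ≤ f x) ∧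
      (∀ x, Monotone fun n => s n x) ∧ ∀ x, Tendsto (fun n => s n x) atTop (𝓝 (f x)) := by
  set g : α → ℝ≥0∞ := fun x => ENNReal.ofReal (f x)
  have hg : Measurable g := hf.ennreal_ofReal
  have hle : ∀ n x, SimpleFunc.eapprox g n x ≤ g x := fun n x =>
    (le_iSup (fun n => SimpleFunc.eapprox g n x) n).trans_eq (SimpleFunc.iSup_eapprox_apply hg x)
  refine ⟨fun n => (SimpleFunc.eapprox g n).map ENNReal.toReal, fun n x => by simp,
    fun n x => ENNReal.toReal_le_of_le_ofReal (h0 x) (hle n x), fun x m n hmn => ?_, fun x => ?_⟩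
  · exact ENNReal.toReal_mono (SimpleFunc.eapprox_lt_top g n x).ne (SimpleFunc.monotone_eapprox g hmn x)
  · have := SimpleFunc.tendsto_eapprox hg x
    have h2 := (ENNReal.tendsto_toReal (a := g x) ENNReal.ofReal_ne_top).comp this
    simpa [g, ENNReal.toReal_ofReal (h0 x), Function.comp_def] using h2

theorem exists_simpleFunc_uniform {u : α → ℝ} (hu : Measurable u) (h1 : ∀ x, |u x| ≤ 1) {ε : ℝ}
    (hε : 0 < ε) : ∃ s : SimpleFunc α ℝ, ∀ x, |u x - s x| ≤ ε := by
  have hfin : (range fun x => ⌊u x / ε⌋).Finite := by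
    refine (Set.finite_Icc ⌊-1 / ε⌋ ⌊1 / ε⌋).subset ?_
    rintro _ ⟨x, rfl⟩
    have := abs_le.1 (h1 x)
    exact ⟨Int.floor_mono (by gcongr; exact this.1), Int.floor_mono (by gcongr; exact this.2)⟩
  let s : SimpleFunc α ℤ := ⟨fun x => ⌊u x / ε⌋, fun k => (hu.div_const ε).floor (measurableSet_singleton k), hfin⟩
  refine ⟨s.map fun k : ℤ => (k : ℝ) * ε, fun x => ?_⟩
  have h2 : ((⌊u x / ε⌋ : ℤ) : ℝ) * ε ≤ u x := by
    rw [← le_div_iff₀ hε]; exact Int.floor_le _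
  have h3 : u x < (⌊u x / ε⌋ + 1 : ℝ) * ε := by
    rw [← div_lt_iff₀ hε]; exact Int.lt_floor_add_one _
  change |u x - (⌊u x / ε⌋ : ℝ) * ε| ≤ ε
  rw [abs_of_nonneg (by linarith)]
  linarith

end Approximation

section MemL1

variable {α : Type*} [MeasurableSpace α] {E : Type*} [NormedAddCommGroup E] [NormedSpace ℝ E]
  {m : VectorMeasure α E}

theorem scalarMeasure_apply (m : VectorMeasure α E) (φ : StrongDual ℝ E) (A : Set α) :
    scalarMeasure m φ A = φ (m A) := rfl

theorem scalarMeasure_eq_nnnorm_smul (m : VectorMeasure α E) {φ : StrongDual ℝ E} (h0 : φ ≠ 0) :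
    scalarMeasure m φ = ‖φ‖₊ • scalarMeasure m (‖φ‖⁻¹ • φ) := by
  ext A _
  change φ (m A) = ‖φ‖ • (‖φ‖⁻¹ • φ (m A))
  rw [smul_inv_smul₀ (norm_ne_zero_iff.2 h0)]

theorem lintegral_le_l1Norm (m : VectorMeasure α E) (f : α → ℝ) {φ : StrongDual ℝ E}
    (hφ : ‖φ‖ ≤ 1) : ∫⁻ x, ‖f x‖ₑ ∂(scalarMeasure m φ).totalVariation ≤ l1Norm m f :=
  le_iSup₂ (f := fun (φ : StrongDual ℝ E) (_ : ‖φ‖ ≤ 1) =>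
    ∫⁻ x, ‖f x‖ₑ ∂(scalarMeasure m φ).totalVariation) φ hφ

theorem l1Norm_mono {f g : α → ℝ} (h : ∀ x, |f x| ≤ |g x|) : l1Norm m f ≤ l1Norm m g :=
  iSup₂_mono fun _ _ => lintegral_mono fun x => enorm_le_iff_norm_le.2 (h x)

theorem l1Norm_congr {f g : α → ℝ} (h : ∀ x, |f x| = |g x|) : l1Norm m f = l1Norm m g :=
  le_antisymm (l1Norm_mono fun x => (h x).le) (l1Norm_mono fun x => (h x).ge)

theorem l1Norm_congr_ae {f g : α → ℝ}
    (h : ∀ φ : StrongDual ℝ E, f =ᵐ[(scalarMeasure m φ).totalVariation] g) :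
    l1Norm m f = l1Norm m g :=
  iSup_congr fun φ => iSup_congr fun _ => lintegral_congr_ae ((h φ).fun_comp _)

theorem l1Norm_add_le {f g : α → ℝ} (hf : Measurable f) :
    l1Norm m (fun x => f x + g x) ≤ l1Norm m f + l1Norm m g := by
  refine iSup₂_le fun φ hφ => ?_
  calc _ ≤ ∫⁻ x, ‖f x‖ₑ + ‖g x‖ₑ ∂(scalarMeasure m φ).totalVariation :=
        lintegral_mono fun x => enorm_add_le _ _
    _ = _ := lintegral_add_left hf.enorm _
    _ ≤ _ := add_le_add (lintegral_le_l1Norm m f hφ) (lintegral_le_l1Norm m g hφ)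

theorem l1Norm_const_mul (c : ℝ) {f : α → ℝ} (hf : Measurable f) :
    l1Norm m (fun x => c * f x) = ‖c‖ₑ * l1Norm m f := by
  unfold l1Norm
  simp_rw [ENNReal.mul_iSup, enorm_mul]
  exact iSup_congr fun φ => iSup_congr fun _ => lintegral_const_mul _ hf.enorm

theorem l1Norm_le_of_simpleFunc {f : α → ℝ} {B : ℝ≥0∞}
    (h : ∀ s : SimpleFunc α ℝ, (∀ x, 0 ≤ s x) → (∀ x, s x ≤ |f x|) → l1Norm m s ≤ B) :
    l1Norm m f ≤ B :=
  iSup₂_le fun _ hφ => lintegral_enorm_le_of_simpleFunc _ fun s h0 hs =>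
    (lintegral_le_l1Norm m s hφ).trans (h s h0 hs)

theorem integrable_of_l1Norm_lt_top {f : α → ℝ} (hf : Measurable f) (h : l1Norm m f < ∞)
    (φ : StrongDual ℝ E) : Integrable f (scalarMeasure m φ).totalVariation := by
  have key : ∀ ψ : StrongDual ℝ E, ‖ψ‖ ≤ 1 → Integrable f (scalarMeasure m ψ).totalVariation :=
    fun ψ hψ => ⟨hf.aestronglyMeasurable, (lintegral_le_l1Norm m f hψ).trans_lt h⟩
  by_cases h0 : φ = 0
  · exact key φ (by simp [h0])
  have hn : 0 < ‖φ‖ := norm_pos_iff.2 h0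
  set ψ : StrongDual ℝ E := ‖φ‖⁻¹ • φ with hψ
  have h1 := scalarMeasure_eq_nnnorm_smul m h0
  have h2 : (scalarMeasure m φ).totalVariation = ‖φ‖₊ • (scalarMeasure m ψ).totalVariation := by
    rw [h1, SignedMeasure.totalVariation, SignedMeasure.toJordanDecomposition_smul,
      JordanDecomposition.smul_posPart, JordanDecomposition.smul_negPart, ← smul_add]
    rfl
  rw [h2]
  exact (key ψ (by rw [hψ, norm_smul, norm_inv, norm_norm, inv_mul_cancel₀ hn.ne'])).smul_measure_nnreal

/-- `‖∫_A f dm‖ ≤ ‖f‖_{L¹(m)}`. -/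
theorem enorm_le_l1Norm {f : α → ℝ} {A : Set α} {y : E}
    (hy : ∀ φ : StrongDual ℝ E, φ y = signedIntegral (scalarMeasure m φ) A f) :
    ‖y‖ₑ ≤ l1Norm m f := by
  obtain ⟨φ, hφ, hφy⟩ := exists_dual_vector'' ℝ y
  have h1 : ‖y‖ₑ = ‖φ y‖ₑ := by rw [hφy]; simp
  rw [h1, hy]
  exact (enorm_signedIntegral_le _ _ _).trans (lintegral_le_l1Norm m f hφ)

theorem MemL1.congr {f g : α → ℝ} (hf : MemL1 m f) (hg : Measurable g)
    (h : ∀ φ : StrongDual ℝ E, f =ᵐ[(scalarMeasure m φ).totalVariation] g) : MemL1 m g := by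
  refine ⟨hg, fun φ => (hf.2.1 φ).congr (h φ), fun A hA => ?_⟩
  obtain ⟨y, hy⟩ := hf.2.2 A hA
  exact ⟨y, fun φ => (hy φ).trans (signedIntegral_congr A (h φ))⟩

theorem MemL1.add {f g : α → ℝ} (hf : MemL1 m f) (hg : MemL1 m g) :
    MemL1 m (fun x => f x + g x) := by
  refine ⟨hf.1.add hg.1, fun φ => (hf.2.1 φ).add (hg.2.1 φ), fun A hA => ?_⟩
  obtain ⟨y, hy⟩ := hf.2.2 A hA
  obtain ⟨z, hz⟩ := hg.2.2 A hA
  exact ⟨y + z, fun φ => by rw [map_add, hy, hz, signedIntegral_add A (hf.2.1 φ) (hg.2.1 φ)]⟩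

theorem MemL1.const_mul {f : α → ℝ} (hf : MemL1 m f) (c : ℝ) : MemL1 m (fun x => c * f x) := by
  refine ⟨hf.1.const_mul c, fun φ => (hf.2.1 φ).const_mul c, fun A hA => ?_⟩
  obtain ⟨y, hy⟩ := hf.2.2 A hA
  exact ⟨c • y, fun φ => by rw [map_smul, hy, signedIntegral_const_mul, smul_eq_mul]⟩

theorem MemL1.sub {f g : α → ℝ} (hf : MemL1 m f) (hg : MemL1 m g) :
    MemL1 m (fun x => f x - g x) := by
  simpa [sub_eq_add_neg] using hf.add (hg.const_mul (-1))

theorem MemL1.indicator {f : α → ℝ} (hf : MemL1 m f) {B : Set α} (hB : MeasurableSet B) :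
    MemL1 m (B.indicator f) := by
  refine ⟨hf.1.indicator hB, fun φ => (hf.2.1 φ).indicator hB, fun A hA => ?_⟩
  obtain ⟨y, hy⟩ := hf.2.2 (A ∩ B) (hA.inter hB)
  exact ⟨y, fun φ => by rw [hy, signedIntegral_indicator _ _ hB]⟩

theorem memL1_const (m : VectorMeasure α E) (c : ℝ) : MemL1 m (fun _ => c) :=
  ⟨measurable_const, fun _ => integrable_const c, fun A hA => ⟨c • m A, fun φ => by
    rw [map_smul, signedIntegral_const _ hA, scalarMeasure_apply, smul_eq_mul]⟩⟩

theorem MemL1.mul_simpleFunc {f : α → ℝ} (hf : MemL1 m f) (s : SimpleFunc α ℝ) :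
    MemL1 m (fun x => f x * s x) := by
  induction s using SimpleFunc.induction with
  | @const c B hB =>
    convert (hf.const_mul c).indicator hB using 2 with x
    by_cases hx : x ∈ B <;> simp [hx, mul_comm]
  | add _ h1 h2 =>
    convert h1.add h2 using 2
    simp [mul_add]

/-- The norm of an element of `L¹(m)` is finite. -/
theorem MemL1.l1Norm_lt_top {f : α → ℝ} (hf : MemL1 m f) : l1Norm m f < ∞ := by
  choose y hy using hf.2.2
  have hbd : ∀ φ : StrongDual ℝ E, ∃ C, ∀ i : {A : Set α // MeasurableSet A},
      ‖NormedSpace.inclusionInDoubleDual ℝ E (y i.1 i.2) φ‖ ≤ C := by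
    intro φ
    refine ⟨(∫⁻ x, ‖f x‖ₑ ∂(scalarMeasure m φ).totalVariation).toReal, fun i => ?_⟩
    rw [NormedSpace.dual_def, hy]
    rw [← toReal_enorm]
    exact ENNReal.toReal_mono (hf.2.1 φ).2.ne (enorm_signedIntegral_le _ _ _)
  obtain ⟨C, hC⟩ := banach_steinhaus hbd
  have hC' : ∀ A hA, ‖y A hA‖ ≤ C := fun A hA => by
    refine le_of_eq_of_le ?_ (hC ⟨A, hA⟩)
    exact ((NormedSpace.inclusionInDoubleDualLi ℝ (E := E)).norm_map _).symm
  refine lt_of_le_of_lt (b := ENNReal.ofReal (C + C)) (iSup₂_le fun φ hφ => ?_) ENNReal.ofReal_lt_top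
  obtain ⟨Q, hQ, h⟩ := exists_signedIntegral_signs (scalarMeasure m φ) hf.1 (hf.2.1 φ)
  rw [h]
  refine ENNReal.ofReal_le_ofReal ?_
  have h1 : signedIntegral (scalarMeasure m φ) univ (fun x => Q.indicator f x - Qᶜ.indicator f x)
      = φ (y Q hQ) - φ (y Qᶜ hQ.compl) := by
    have := signedIntegral_add univ ((hf.2.1 φ).indicator hQ)
      (((hf.2.1 φ).indicator hQ.compl).const_mul (-1))
    rw [signedIntegral_const_mul, signedIntegral_indicator _ _ hQ,
      signedIntegral_indicator _ _ hQ.compl, univ_inter, univ_inter, ← hy, ← hy] at this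
    simpa [sub_eq_add_neg] using this
  have h2 : ∀ A hA, |φ (y A hA)| ≤ C := fun A hA =>
    (φ.le_of_opNorm_le hφ _).trans (by rw [one_mul]; exact hC' A hA)
  rw [h1]
  linarith [(abs_le.1 (h2 Q hQ)).2, (abs_le.1 (h2 _ hQ.compl)).1]

theorem signedIntegral_sub {l : SignedMeasure α} {f g : α → ℝ} (A : Set α)
    (hf : Integrable f l.totalVariation) (hg : Integrable g l.totalVariation) :
    signedIntegral l A (fun x => f x - g x) = signedIntegral l A f - signedIntegral l A g := by
  have := signedIntegral_add A hf (hg.const_mul (-1))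
  rw [signedIntegral_const_mul] at this
  simpa [sub_eq_add_neg] using this

/-- If `f` is close in `L¹(m)` to `g` with integral `y`, then integrals against `φ` are close. -/
theorem enorm_sub_signedIntegral_le {f g : α → ℝ} {A : Set α} {y : E} {φ : StrongDual ℝ E}
    (hφ : ‖φ‖ ≤ 1) (hf : Integrable f (scalarMeasure m φ).totalVariation)
    (hg : Integrable g (scalarMeasure m φ).totalVariation)
    (hy : φ y = signedIntegral (scalarMeasure m φ) A g) :
    ‖φ y - signedIntegral (scalarMeasure m φ) A f‖ₑ ≤ l1Norm m (fun x => g x - f x) := by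
  rw [hy, ← signedIntegral_sub A hg hf]
  exact (enorm_signedIntegral_le _ _ _).trans (lintegral_le_l1Norm m _ hφ)

/-- Homogeneity: it suffices to test integrals on the unit ball of the dual. -/
theorem integral_of_unit_ball {f : α → ℝ} {A : Set α} {y : E}
    (h : ∀ φ : StrongDual ℝ E, ‖φ‖ ≤ 1 → φ y = signedIntegral (scalarMeasure m φ) A f)
    (φ : StrongDual ℝ E) : φ y = signedIntegral (scalarMeasure m φ) A f := by
  by_cases h0 : φ = 0
  · exact h φ (by simp [h0])
  have hn : 0 < ‖φ‖ := norm_pos_iff.2 h0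
  have hψ := h (‖φ‖⁻¹ • φ) (by rw [norm_smul, norm_inv, norm_norm, inv_mul_cancel₀ hn.ne'])
  have h1 := scalarMeasure_eq_nnnorm_smul m h0
  have h2 : signedIntegral (scalarMeasure m φ) A f =
      ‖φ‖ * signedIntegral (scalarMeasure m (‖φ‖⁻¹ • φ)) A f := by
    rw [h1]
    unfold signedIntegral
    rw [SignedMeasure.toJordanDecomposition_smul, JordanDecomposition.smul_posPart,
      JordanDecomposition.smul_negPart, Measure.restrict_smul, Measure.restrict_smul,
      integral_smul_nnreal_measure, integral_smul_nnreal_measure, ← smul_sub]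
    rfl
  rw [h2, ← hψ, smul_apply, smul_eq_mul, mul_inv_cancel_left₀ hn.ne']

/-- A limit of integrals is the integral of the limit in `L¹(m)`. -/
theorem integral_of_tendsto {f : α → ℝ} {g : ℕ → α → ℝ} {A : Set α} {y : E} {z : ℕ → E}
    (hf : ∀ φ : StrongDual ℝ E, Integrable f (scalarMeasure m φ).totalVariation)
    (hg : ∀ n, ∀ φ : StrongDual ℝ E, Integrable (g n) (scalarMeasure m φ).totalVariation)
    (hz : ∀ n, ∀ φ : StrongDual ℝ E, φ (z n) = signedIntegral (scalarMeasure m φ) A (g n))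
    (hzy : Tendsto z atTop (𝓝 y))
    (hgf : Tendsto (fun n => l1Norm m (fun x => g n x - f x)) atTop (𝓝 0)) (φ : StrongDual ℝ E) :
    φ y = signedIntegral (scalarMeasure m φ) A f := by
  refine integral_of_unit_ball (fun φ hφ => ?_) φ
  have h1 : Tendsto (fun n => φ (z n)) atTop (𝓝 (φ y)) := (φ.continuous.tendsto y).comp hzy
  refine tendsto_nhds_unique h1 ?_
  rw [tendsto_iff_edist_tendsto_0]
  refine tendsto_of_tendsto_of_tendsto_of_le_of_le tendsto_const_nhds hgf (fun _ => zero_le)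
    fun n => ?_
  rw [edist_eq_enorm_sub]
  exact enorm_sub_signedIntegral_le hφ (hf φ) (hg n φ) (hz n φ)

theorem memL1_of_tendsto [CompleteSpace E] {f : α → ℝ} {g : ℕ → α → ℝ} (hf : Measurable f)
    (hg : ∀ n, MemL1 m (g n))
    (hgf : Tendsto (fun n => l1Norm m (fun x => g n x - f x)) atTop (𝓝 0)) : MemL1 m f := by
  have hfin : l1Norm m f < ∞ := by
    obtain ⟨n, hn⟩ := ((tendsto_order.1 hgf).2 1 one_pos).exists
    refine lt_of_le_of_lt (b := l1Norm m (g n) + l1Norm m (fun x => g n x - f x)) ?_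
      (ENNReal.add_lt_top.2 ⟨(hg n).l1Norm_lt_top, hn.trans ENNReal.one_lt_top⟩)
    have h1 : l1Norm m (fun x => g n x - f x) = l1Norm m (fun x => f x - g n x) :=
      l1Norm_congr fun x => abs_sub_comm _ _
    rw [h1]
    simpa using l1Norm_add_le (m := m) (g := fun x => f x - g n x) (hg n).1
  have hfi := integrable_of_l1Norm_lt_top hf hfin
  refine ⟨hf, hfi, fun A hA => ?_⟩
  choose z hz using fun n => (hg n).2.2 A hA
  have hcau : CauchySeq z := by
    rw [EMetric.cauchySeq_iff]
    intro ε hε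
    obtain ⟨N, hN⟩ := eventually_atTop.1 ((tendsto_order.1 hgf).2 (ε / 2) (ENNReal.half_pos hε.ne'))
    refine ⟨N, fun i hi j hj => ?_⟩
    rw [edist_eq_enorm_sub]
    refine lt_of_le_of_lt (enorm_le_l1Norm (m := m) (f := fun x => g i x - g j x) (A := A)
      fun φ => ?_) ?_
    · rw [map_sub, hz, hz, signedIntegral_sub A ((hg i).2.1 φ) ((hg j).2.1 φ)]
    · calc l1Norm m (fun x => g i x - g j x)
          = l1Norm m (fun x => (g i x - f x) + (f x - g j x)) := by simp
        _ ≤ _ := l1Norm_add_le ((hg i).1.sub hf)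
        _ = l1Norm m (fun x => g i x - f x) + l1Norm m (fun x => g j x - f x) := by
          congr 1; exact l1Norm_congr fun x => abs_sub_comm _ _
        _ < ε / 2 + ε / 2 := ENNReal.add_lt_add (hN i hi) (hN j hj)
        _ = ε := ENNReal.add_halves ε
  obtain ⟨y, hy⟩ := cauchySeq_tendsto_of_complete hcau
  exact ⟨y, integral_of_tendsto hfi (fun n => (hg n).2.1) hz hy hgf⟩

/-- `L¹(m)` is an ideal. -/
theorem MemL1.mono [CompleteSpace E] {f g : α → ℝ} (hg : MemL1 m g) (hf : Measurable f)
    (h : ∀ x, |f x| ≤ |g x|) : MemL1 m f := by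
  have hu1 : ∀ x, |f x / g x| ≤ 1 := fun x => by
    rw [abs_div]; exact div_le_one_of_le₀ (h x) (abs_nonneg _)
  have hfu : ∀ x, f x = g x * (f x / g x) := fun x => by
    by_cases hx : g x = 0
    · have := h x
      rw [hx, abs_zero] at this
      simp [hx, abs_nonpos_iff.1 this]
    · field_simp
  choose s hs using fun n : ℕ => exists_simpleFunc_uniform (hf.div hg.1) hu1
    (Nat.one_div_pos_of_nat (α := ℝ) (n := n))
  refine memL1_of_tendsto hf (fun n => hg.mul_simpleFunc (s n)) ?_
  have hb : ∀ n : ℕ, l1Norm m (fun x => g x * s n x - f x) ≤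
      ENNReal.ofReal (1 / ((n : ℝ) + 1)) * l1Norm m g := fun n => by
    have h0 : (0 : ℝ) ≤ 1 / ((n : ℝ) + 1) := by positivity
    rw [← Real.enorm_of_nonneg h0, ← l1Norm_const_mul _ hg.1]
    refine l1Norm_mono fun x => ?_
    rw [abs_mul, abs_of_nonneg h0]
    have h2 : g x * s n x - f x = g x * (s n x - f x / g x) := by rw [mul_sub, ← hfu x]
    rw [h2, abs_mul, abs_sub_comm, mul_comm]
    exact mul_le_mul_of_nonneg_right (hs n x) (abs_nonneg _)
  refine tendsto_of_tendsto_of_tendsto_of_le_of_le tendsto_const_nhds ?_ (fun _ => zero_le) hb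
  have h1 := ENNReal.tendsto_ofReal (tendsto_one_div_add_atTop_nhds_zero_nat (𝕜 := ℝ))
  simpa using ENNReal.Tendsto.mul_const h1 (Or.inr hg.l1Norm_lt_top.ne)

theorem MemL1.abs [CompleteSpace E] {f : α → ℝ} (hf : MemL1 m f) : MemL1 m (fun x => |f x|) :=
  hf.mono (by have := hf.1; fun_prop) fun x => by simp

theorem memL1_simpleFunc [CompleteSpace E] (s : SimpleFunc α ℝ) : MemL1 m s := by
  simpa using (memL1_const m 1).mul_simpleFunc s

theorem MemL1.sum {ι : Type*} (t : Finset ι) {f : ι → α → ℝ} (hf : ∀ i, MemL1 m (f i)) :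
    MemL1 m (fun x => ∑ i ∈ t, f i x) := by
  classical
  induction t using Finset.induction_on with
  | empty => simpa using memL1_const m 0
  | insert i t hi ih => simpa [Finset.sum_insert hi] using (hf i).add ih

end MemL1

end ConjWeights

namespace ConjWeights

section Weighted

variable {α : Type*} [MeasurableSpace α] {ν : Measure α}

theorem isFiniteMeasure_weighted (w : Lp ℝ 1 ν) : IsFiniteMeasure (weighted ν w) :=
  isFiniteMeasure_withDensity_ofReal (L1.integrable_coeFn w).2

theorem weighted_absolutelyContinuous (w : Lp ℝ 1 ν) : weighted ν w ≪ ν :=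
  withDensity_absolutelyContinuous _ _

theorem lintegral_mul_weight (w : Lp ℝ 1 ν) {f : α → ℝ} (hf : Measurable f) :
    ∫⁻ x, ENNReal.ofReal (|f x| * w x) ∂ν = ∫⁻ x, ‖f x‖ₑ ∂weighted ν w := by
  unfold weighted
  rw [lintegral_withDensity_eq_lintegral_mul₀ (Lp.aestronglyMeasurable w).aemeasurable.ennreal_ofReal
    hf.enorm.aemeasurable]
  refine lintegral_congr fun x => ?_
  rw [ENNReal.ofReal_mul (abs_nonneg _), Pi.mul_apply, mul_comm, Real.enorm_eq_ofReal_abs]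

theorem exists_weight [SigmaFinite ν] (κ : Measure α) [IsFiniteMeasure κ] (h : κ ≪ ν) :
    ∃ w : Lp ℝ 1 ν, 0 ≤ w ∧ weighted ν w = κ := by
  have hi : Integrable (fun x => (κ.rnDeriv ν x).toReal) ν := Measure.integrable_toReal_rnDeriv
  refine ⟨hi.toL1, ?_, ?_⟩
  · rw [← Lp.coeFn_nonneg]
    filter_upwards [hi.coeFn_toL1] with x hx
    rw [hx]
    exact ENNReal.toReal_nonneg
  · refine Eq.trans (withDensity_congr_ae ?_) (Measure.withDensity_rnDeriv_eq κ ν h)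
    filter_upwards [hi.coeFn_toL1, κ.rnDeriv_lt_top ν] with x hx hx'
    rw [hx, ENNReal.ofReal_toReal hx'.ne]

theorem enorm_abs_rpow (x : ℝ) {q : ℝ} (hq : 0 ≤ q) : ‖|x| ^ q‖ₑ = ‖x‖ₑ ^ q := by
  rw [Real.enorm_rpow_of_nonneg (abs_nonneg x) hq, Real.enorm_abs]

theorem lintegral_abs_rpow {p : ℝ≥0∞} (hp1 : 1 ≤ p) (hp : p ≠ ∞) (f : α → ℝ) (κ : Measure α) :
    ∫⁻ x, ‖|f x| ^ p.toReal‖ₑ ∂κ = eLpNorm f p κ ^ p.toReal := by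
  have h0 : p ≠ 0 := (one_pos.trans_le hp1).ne'
  have hq : 0 < p.toReal := ENNReal.toReal_pos h0 hp
  rw [eLpNorm_eq_lintegral_rpow_enorm_toReal h0 hp, ← ENNReal.rpow_mul,
    one_div_mul_cancel hq.ne', ENNReal.rpow_one]
  exact lintegral_congr fun x => enorm_abs_rpow _ hq.le

theorem sum_eLpNorm_rpow {p : ℝ≥0∞} (hp1 : 1 ≤ p) (hp : p ≠ ∞) {ι : Type*} [Fintype ι]
    {f : ι → α → ℝ} (hf : ∀ i, Measurable (f i)) (κ : Measure α) :
    ∑ i, eLpNorm (f i) p κ ^ p.toReal = ∫⁻ x, ‖∑ i, |f i x| ^ p.toReal‖ₑ ∂κ := by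
  simp_rw [← lintegral_abs_rpow hp1 hp]
  rw [← lintegral_finsetSum _ fun i _ => by have := hf i; fun_prop]
  refine lintegral_congr fun x => ?_
  rw [Real.enorm_of_nonneg (Finset.sum_nonneg fun i _ => by positivity),
    ENNReal.ofReal_sum_of_nonneg fun i _ => by positivity]
  exact Finset.sum_congr rfl fun i _ => Real.enorm_of_nonneg (by positivity)

theorem abs_sum_rpow_rpow {q : ℝ} (hq : 0 < q) {ι : Type*} [Fintype ι] (a : ι → ℝ) :
    |(∑ i, |a i| ^ q) ^ (1 / q)| ^ q = ∑ i, |a i| ^ q := by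
  have h0 : 0 ≤ ∑ i, |a i| ^ q := Finset.sum_nonneg fun i _ => by positivity
  rw [abs_of_nonneg (by positivity), one_div, Real.rpow_inv_rpow h0 hq.ne']

end Weighted

namespace BanachFunctionSpace

variable {α : Type*} [MeasurableSpace α] {ν : Measure α} (X : BanachFunctionSpace ν)

/-- The linear map that sends a simple function to its class. -/
def ofSimple : SimpleFunc α ℝ →ₗ[ℝ] X.carrier where
  toFun s := ⟨simpleClass ν s, X.simple_mem s⟩
  map_add' _ _ := Subtype.ext (AEEqFun.ext (by
    refine (AEEqFun.coeFn_mk _ _).trans ((AEEqFun.coeFn_add _ _).trans ?_).symm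
    exact (AEEqFun.coeFn_mk _ _).add (AEEqFun.coeFn_mk _ _)))
  map_smul' c _ := Subtype.ext (AEEqFun.ext (by
    refine (AEEqFun.coeFn_mk _ _).trans ((AEEqFun.coeFn_smul _ _).trans ?_).symm
    exact (AEEqFun.coeFn_mk _ _).const_smul c))

theorem coe_ofSimple (s : SimpleFunc α ℝ) : (X.ofSimple s : α →ₘ[ν] ℝ) =ᵐ[ν] s :=
  AEEqFun.coeFn_mk _ _

theorem ofSimple_piecewise_const {B : Set α} (hB : MeasurableSet B) (c : ℝ) :
    X.ofSimple (SimpleFunc.piecewise B hB (SimpleFunc.const _ c) (SimpleFunc.const _ 0)) =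
      c • X.ind B hB := by
  refine Subtype.ext (AEEqFun.ext ((X.coe_ofSimple _).trans ?_))
  filter_upwards [AEEqFun.coeFn_smul c (chi ν B hB), chi_coe ν B hB] with x h2 h3
  refine Eq.trans ?_ h2.symm
  rw [Pi.smul_apply, h3]
  by_cases hx : x ∈ B <;> simp [hx]

variable {X}

theorem abs_le_of_ae {f g : α →ₘ[ν] ℝ} (h : ∀ᵐ x ∂ν, |f x| ≤ |g x|) : |f| ≤ |g| := by
  rw [← AEEqFun.coeFn_le]
  filter_upwards [h, AEEqFun.coeFn_abs f, AEEqFun.coeFn_abs g] with x h1 h2 h3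
  rwa [h2, h3]

theorem mem_of_ae_le {f : α →ₘ[ν] ℝ} {g : X.carrier}
    (h : ∀ᵐ x ∂ν, |f x| ≤ |(g : α →ₘ[ν] ℝ) x|) : f ∈ X.carrier :=
  (X.ideal f g (abs_le_of_ae h)).1

theorem norm_le_of_ae_le {f g : X.carrier}
    (h : ∀ᵐ x ∂ν, |(f : α →ₘ[ν] ℝ) x| ≤ |(g : α →ₘ[ν] ℝ) x|) : X.norm f ≤ X.norm g :=
  (X.ideal f g (abs_le_of_ae h)).2

theorem extNorm_coe (f : X.carrier) :
    X.extNorm (f : α →ₘ[ν] ℝ) = ENNReal.ofReal (X.norm f) := by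
  simp [extNorm]

/-- A non-negative function of an order continuous space is the norm limit of smaller simple
functions. -/
theorem exists_simpleFunc_tendsto_of_nonneg (hX : X.OrderContinuous) (f : X.carrier)
    (h0 : ∀ᵐ x ∂ν, 0 ≤ (f : α →ₘ[ν] ℝ) x) :
    ∃ s : ℕ → SimpleFunc α ℝ, Tendsto (fun n => X.norm (f - X.ofSimple (s n))) atTop (𝓝 0) := by
  obtain ⟨s, hs0, hsf, hmono, hlim⟩ := exists_simpleFunc_monotone_tendsto
    (f := fun x => max ((f : α →ₘ[ν] ℝ) x) 0)
    ((f : α →ₘ[ν] ℝ).measurable.max measurable_const) (fun x => le_max_right _ _)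
  have hcoe : ∀ᵐ x ∂ν, ∀ n, ((f - X.ofSimple (s n) : X.carrier) : α →ₘ[ν] ℝ) x =
      (f : α →ₘ[ν] ℝ) x - s n x := ae_all_iff.2 fun n => by
    filter_upwards [AEEqFun.coeFn_sub (f : α →ₘ[ν] ℝ) (X.ofSimple (s n) : α →ₘ[ν] ℝ),
      X.coe_ofSimple (s n)] with x h1 h2
    exact h1.trans (by rw [Pi.sub_apply, h2])
  refine ⟨s, hX (fun n => f - X.ofSimple (s n)) (fun m n hmn => ?_) ?_⟩
  · rw [← AEEqFun.coeFn_le]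
    filter_upwards [hcoe] with x hx
    rw [hx, hx]
    exact sub_le_sub_left (hmono x hmn) _
  · filter_upwards [hcoe, h0] with x hx hx0
    simp_rw [hx]
    have := hlim x
    rw [max_eq_left hx0] at this
    simpa using this.const_sub ((f : α →ₘ[ν] ℝ) x)

theorem exists_simpleFunc_tendsto (hX : X.OrderContinuous) (f : X.carrier) :
    ∃ s : ℕ → SimpleFunc α ℝ, Tendsto (fun n => X.norm (f - X.ofSimple (s n))) atTop (𝓝 0) := by
  have hpart : ∀ g : X.carrier, ∃ h : X.carrier, (h : α →ₘ[ν] ℝ) =ᵐ[ν]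
      fun x => max ((g : α →ₘ[ν] ℝ) x) 0 := fun g => by
    have h1 : ((g : α →ₘ[ν] ℝ) ⊔ 0 : α →ₘ[ν] ℝ) =ᵐ[ν] fun x => max ((g : α →ₘ[ν] ℝ) x) 0 := by
      filter_upwards [AEEqFun.coeFn_sup (g : α →ₘ[ν] ℝ) 0,
        AEEqFun.coeFn_zero (μ := ν) (β := ℝ) (α := α)] with x h2 h3
      rw [h2, h3]; rfl
    refine ⟨⟨(g : α →ₘ[ν] ℝ) ⊔ 0, mem_of_ae_le (g := g) ?_⟩, h1⟩
    filter_upwards [h1] with x hx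
    rw [hx]
    exact abs_max_le_max_abs_abs.trans (by simp)
  obtain ⟨a, ha⟩ := hpart f
  obtain ⟨b, hb⟩ := hpart (-f)
  have hab : f = a - b := by
    refine Subtype.ext (AEEqFun.ext ?_)
    filter_upwards [ha, hb, AEEqFun.coeFn_sub (a : α →ₘ[ν] ℝ) b,
      AEEqFun.coeFn_neg (f : α →ₘ[ν] ℝ)] with x h1 h2 h3 h4
    refine Eq.trans ?_ h3.symm
    rw [Pi.sub_apply, h1, h2]
    change _ = _ - max ((-(f : α →ₘ[ν] ℝ) : α →ₘ[ν] ℝ) x) 0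
    rw [h4, Pi.neg_apply]
    exact (max_zero_sub_max_neg_zero_eq_self _).symm
  obtain ⟨s, hs⟩ := exists_simpleFunc_tendsto_of_nonneg hX a (ha.mono fun x hx => by
    rw [hx]; exact le_max_right _ _)
  obtain ⟨t, ht⟩ := exists_simpleFunc_tendsto_of_nonneg hX b (hb.mono fun x hx => by
    rw [hx]; exact le_max_right _ _)
  refine ⟨fun n => s n - t n, squeeze_zero (fun n => apply_nonneg _ _) (fun n => ?_)
    (by simpa using hs.add ht)⟩
  have h1 : f - X.ofSimple (s n - t n) = (a - X.ofSimple (s n)) - (b - X.ofSimple (t n)) := by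
    rw [hab, map_sub]; abel
  rw [h1]
  exact map_sub_le_add _ _ _

end BanachFunctionSpace

section OpMeasure

variable {Ω₁ Ω₂ : Type*} [MeasurableSpace Ω₁] [MeasurableSpace Ω₂] {ν : Measure Ω₁}
  {μ : Measure Ω₂} {X : BanachFunctionSpace ν} {p : ℝ≥0∞} [Fact (1 ≤ p)] {V : Set (Lp ℝ 1 μ)}
  {T : X.carrier →ₗ[ℝ] (Ω₂ →ₘ[μ] ℝ)}

/-- `opVec` as a linear map. -/
noncomputable def opLin (hT : UniformlyBounded p V T) : X.carrier →ₗ[ℝ] RangeSpace p V where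
  toFun := opVec hT
  map_add' := opVec_add hT
  map_smul' c f := by
    ext1
    funext v
    change (hT.memLp (c • f) v).toLp _ = c • (hT.memLp f v).toLp _
    rw [← MemLp.toLp_const_smul, MemLp.toLp_eq_toLp_iff, map_smul]
    exact (withDensity_absolutelyContinuous _ _).ae_le (AEEqFun.coeFn_smul _ _)

theorem coe_opLin (hT : UniformlyBounded p V T) (f : X.carrier) (v : V) :
    opLin hT f v =ᵐ[weighted μ v] T f :=
  (hT.memLp f v).coeFn_toLp

theorem enorm_opLin_apply (hT : UniformlyBounded p V T) (f : X.carrier) (v : V) :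
    ‖opLin hT f v‖ₑ = eLpNorm (T f) p (weighted μ v) :=
  Lp.enorm_toLp (hT.memLp f v)

theorem tendsto_opLin (hT : UniformlyBounded p V T) {f : X.carrier} {g : ℕ → X.carrier}
    (h : Tendsto (fun n => X.norm (f - g n)) atTop (𝓝 0)) :
    Tendsto (fun n => opLin hT (g n)) atTop (𝓝 (opLin hT f)) := by
  obtain ⟨C, hC⟩ := norm_opVec_le hT
  rw [tendsto_iff_norm_sub_tendsto_zero]
  refine squeeze_zero (fun _ => norm_nonneg _) (fun n => ?_) (by simpa using h.const_mul (C : ℝ))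
  rw [norm_sub_rev, ← map_sub]
  exact hC _

variable (hX : X.OrderContinuous) (hT : UniformlyBounded p V T)

theorem opMeasure_apply {A : Set Ω₁} (hA : MeasurableSet A) :
    opMeasure hX hT A = opLin hT (X.ind A hA) :=
  dif_pos hA

theorem opMeasure_absolutelyContinuous (φ : StrongDual ℝ (RangeSpace p V)) :
    (scalarMeasure (opMeasure hX hT) φ).totalVariation ≪ ν := by
  have h : scalarMeasure (opMeasure hX hT) φ ≪ᵥ ν.toENNRealVectorMeasure := by
    refine VectorMeasure.AbsolutelyContinuous.mk fun A hA h0 => ?_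
    rw [Measure.toENNRealVectorMeasure_apply_measurable hA] at h0
    have h1 : X.ind A hA = 0 := by
      refine Subtype.ext (AEEqFun.ext ((chi_coe ν A hA).trans ?_))
      filter_upwards [measure_eq_zero_iff_ae_notMem.1 h0,
        AEEqFun.coeFn_zero (μ := ν) (β := ℝ) (α := Ω₁)] with x hx hx'
      exact (indicator_of_notMem hx _).trans hx'.symm
    rw [scalarMeasure_apply, opMeasure_apply hX hT hA, h1, map_zero, map_zero]
  rwa [SignedMeasure.absolutelyContinuous_ennreal_iff, VectorMeasure.ennrealToMeasure_toENNRealVectorMeasure]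
    at h

theorem ae_opMeasure {P : Ω₁ → Prop} (h : ∀ᵐ x ∂ν, P x) (φ : StrongDual ℝ (RangeSpace p V)) :
    ∀ᵐ x ∂(scalarMeasure (opMeasure hX hT) φ).totalVariation, P x :=
  (opMeasure_absolutelyContinuous hX hT φ).ae_le h

theorem integral_simpleFunc_opMeasure (s : SimpleFunc Ω₁ ℝ) (φ : StrongDual ℝ (RangeSpace p V)) :
    φ (opLin hT (X.ofSimple s)) =
      signedIntegral (scalarMeasure (opMeasure hX hT) φ) univ s := by
  induction s using SimpleFunc.induction with
  | @const c B hB =>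
    have h2 : ⇑(SimpleFunc.piecewise B hB (SimpleFunc.const _ c) (SimpleFunc.const _ 0)) =
        B.indicator fun _ => c := by
      ext x
      by_cases hx : x ∈ B <;> simp [hx]
    rw [X.ofSimple_piecewise_const, h2, signedIntegral_indicator _ _ hB, univ_inter, signedIntegral_const _ hB,
      scalarMeasure_apply, opMeasure_apply hX hT hB, map_smul, map_smul, smul_eq_mul]
  | @add s t _ hs ht =>
    rw [map_add, map_add, map_add, hs, ht]
    exact (signedIntegral_add univ ((memL1_simpleFunc s).2.1 φ) ((memL1_simpleFunc t).2.1 φ)).symm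

theorem l1Norm_opMeasure_simpleFunc_le {s : SimpleFunc Ω₁ ℝ} {B : ℝ≥0∞}
    (h : ∀ t : SimpleFunc Ω₁ ℝ, (∀ x, |t x| = |s x|) → ‖opLin hT (X.ofSimple t)‖ₑ ≤ B) :
    l1Norm (opMeasure hX hT) s ≤ B := by
  refine iSup₂_le fun φ hφ => ?_
  obtain ⟨Q, hQ, h1⟩ := exists_signedIntegral_signs (scalarMeasure (opMeasure hX hT) φ)
    s.measurable ((memL1_simpleFunc s).2.1 φ)
  set t : SimpleFunc Ω₁ ℝ := SimpleFunc.piecewise Q hQ s (-s) with ht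
  have h2 : (fun x => Q.indicator s x - Qᶜ.indicator s x) = t := by
    ext x
    by_cases hx : x ∈ Q <;> simp [ht, hx]
  rw [h1, h2, ← integral_simpleFunc_opMeasure]
  refine le_trans ?_ (h t fun x => ?_)
  · rw [← ofReal_norm]
    exact ENNReal.ofReal_le_ofReal ((le_abs_self _).trans
      ((φ.le_of_opNorm_le hφ _).trans_eq (one_mul _)))
  · by_cases hx : x ∈ Q <;> simp [ht, hx]

theorem exists_l1Norm_opMeasure_le : ∃ C : ℝ≥0, ∀ f : X.carrier,
    l1Norm (opMeasure hX hT) (f : Ω₁ →ₘ[ν] ℝ) ≤ C * ENNReal.ofReal (X.norm f) := by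
  obtain ⟨C, hC⟩ := norm_opVec_le hT
  refine ⟨C, fun f => l1Norm_le_of_simpleFunc fun s h0 hs =>
    l1Norm_opMeasure_simpleFunc_le hX hT fun t ht => ?_⟩
  rw [← ofReal_norm, ← ENNReal.ofReal_coe_nnreal, ← ENNReal.ofReal_mul C.coe_nonneg]
  refine ENNReal.ofReal_le_ofReal ((hC _).trans (mul_le_mul_of_nonneg_left
    (BanachFunctionSpace.norm_le_of_ae_le ?_) C.coe_nonneg))
  filter_upwards [X.coe_ofSimple t] with x hx
  rw [hx, ht, abs_of_nonneg (h0 x)]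
  exact hs x

theorem l1Norm_sub_tendsto {f : X.carrier} {s : ℕ → SimpleFunc Ω₁ ℝ}
    (h : Tendsto (fun n => X.norm (f - X.ofSimple (s n))) atTop (𝓝 0)) :
    Tendsto (fun n => l1Norm (opMeasure hX hT) fun x => s n x - (f : Ω₁ →ₘ[ν] ℝ) x)
      atTop (𝓝 0) := by
  obtain ⟨C, hC⟩ := exists_l1Norm_opMeasure_le hX hT
  have h1 := ENNReal.Tendsto.const_mul (a := (C : ℝ≥0∞)) (ENNReal.tendsto_ofReal h)
    (Or.inr ENNReal.coe_ne_top)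
  rw [ENNReal.ofReal_zero, mul_zero] at h1
  refine tendsto_of_tendsto_of_tendsto_of_le_of_le tendsto_const_nhds h1 (fun _ => zero_le)
    fun n => le_of_eq_of_le ?_ (hC _)
  rw [l1Norm_congr (g := fun x => (f : Ω₁ →ₘ[ν] ℝ) x - s n x) fun x => abs_sub_comm _ _]
  refine l1Norm_congr_ae fun φ => ae_opMeasure hX hT ?_ φ
  filter_upwards [AEEqFun.coeFn_sub (f : Ω₁ →ₘ[ν] ℝ) (X.ofSimple (s n) : Ω₁ →ₘ[ν] ℝ),
      X.coe_ofSimple (s n)] with x h1 h2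
  exact ((h1.trans (by rw [Pi.sub_apply, h2]))).symm

/-- `X` is contained in `L¹(m_T)`. -/
theorem memL1_opMeasure (f : X.carrier) : MemL1 (opMeasure hX hT) (f : Ω₁ →ₘ[ν] ℝ) := by
  obtain ⟨s, hs⟩ := BanachFunctionSpace.exists_simpleFunc_tendsto hX f
  exact memL1_of_tendsto (f : Ω₁ →ₘ[ν] ℝ).measurable (fun n => memL1_simpleFunc (s n))
    (l1Norm_sub_tendsto hX hT hs)

/-- `T f = ∫ f dm_T` for `f` in `X`. -/
theorem integral_opMeasure (f : X.carrier) (φ : StrongDual ℝ (RangeSpace p V)) :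
    φ (opLin hT f) =
      signedIntegral (scalarMeasure (opMeasure hX hT) φ) univ (f : Ω₁ →ₘ[ν] ℝ) := by
  obtain ⟨s, hs⟩ := BanachFunctionSpace.exists_simpleFunc_tendsto hX f
  exact integral_of_tendsto (memL1_opMeasure hX hT f).2.1 (fun n => (memL1_simpleFunc (s n)).2.1)
    (fun n => integral_simpleFunc_opMeasure hX hT (s n)) (tendsto_opLin hT hs)
    (l1Norm_sub_tendsto hX hT hs) φ

end OpMeasure

end ConjWeights

namespace ConjWeights

section LpVec

variable {α : Type*} [MeasurableSpace α] {E : Type*} [NormedAddCommGroup E] [NormedSpace ℝ E]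
  {m : VectorMeasure α E} {p : ℝ≥0∞}

theorem memL1_of_forall_exists [CompleteSpace E] {f : α → ℝ} (hf : Measurable f)
    (h : ∀ ε : ℝ≥0∞, 0 < ε → ∃ g, MemL1 m g ∧ l1Norm m (fun x => g x - f x) ≤ ε) : MemL1 m f := by
  choose g hg hgf using fun n : ℕ => h ((n : ℝ≥0∞) + 1)⁻¹ (by simp)
  refine memL1_of_tendsto hf hg (tendsto_of_tendsto_of_tendsto_of_le_of_le tendsto_const_nhds ?_
    (fun _ => zero_le) hgf)
  have := (tendsto_add_atTop_iff_nat 1).2 ENNReal.tendsto_inv_nat_nhds_zero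
  simpa using this

theorem MemL1.of_l1Norm_sub_eq_zero [CompleteSpace E] {f g : α → ℝ} (hg : MemL1 m g)
    (hf : Measurable f) (h : l1Norm m (fun x => g x - f x) = 0) : MemL1 m f :=
  memL1_of_forall_exists hf fun _ _ => ⟨g, hg, h.le.trans zero_le⟩

theorem MemLpVec.mono [CompleteSpace E] {f g : α → ℝ} (hg : MemLpVec m p g) (hf : Measurable f)
    (h : ∀ x, |f x| ≤ |g x|) : MemLpVec m p f := by
  refine ⟨hf, hg.2.mono (by fun_prop) fun x => ?_⟩
  refine abs_le_abs_of_nonneg (by positivity) ?_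
  exact Real.rpow_le_rpow (abs_nonneg _) (h x) ENNReal.toReal_nonneg

theorem abs_add_rpow_le (a b : ℝ) {q : ℝ} (hq : 0 ≤ q) :
    |a + b| ^ q ≤ 2 ^ q * (|a| ^ q + |b| ^ q) := by
  have h1 : |a + b| ≤ 2 * max |a| |b| :=
    (abs_add_le a b).trans (by linarith [le_max_left |a| |b|, le_max_right |a| |b|])
  refine (Real.rpow_le_rpow (abs_nonneg _) h1 hq).trans ?_
  rw [Real.mul_rpow (by norm_num) (by positivity)]
  gcongr
  have ha : 0 ≤ |a| ^ q := by positivity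
  have hb : 0 ≤ |b| ^ q := by positivity
  rcases max_cases |a| |b| with h | h <;> rw [h.1] <;> linarith

theorem MemLpVec.add [CompleteSpace E] {f g : α → ℝ} (hf : MemLpVec m p f) (hg : MemLpVec m p g) :
    MemLpVec m p (fun x => f x + g x) := by
  have hfm := hf.1
  have hgm := hg.1
  refine ⟨by fun_prop, ((hf.2.add hg.2).const_mul (2 ^ p.toReal)).mono (by fun_prop) fun x => ?_⟩
  refine abs_le_abs_of_nonneg (by positivity) ?_
  exact abs_add_rpow_le _ _ ENNReal.toReal_nonneg

theorem MemLpVec.const_mul {f : α → ℝ} (hf : MemLpVec m p f) (c : ℝ) :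
    MemLpVec m p (fun x => c * f x) := by
  refine ⟨hf.1.const_mul c, ?_⟩
  simp_rw [abs_mul, Real.mul_rpow (abs_nonneg _) (abs_nonneg _)]
  exact hf.2.const_mul _

theorem memLpVec_simpleFunc [CompleteSpace E] (s : SimpleFunc α ℝ) : MemLpVec m p s :=
  ⟨s.measurable, memL1_simpleFunc (s.map fun x => |x| ^ p.toReal)⟩

theorem MemLpVec.memL1 [CompleteSpace E] (hp1 : 1 ≤ p) (hp : p ≠ ∞) {f : α → ℝ}
    (hf : MemLpVec m p f) : MemL1 m f := by
  refine ((memL1_const m 1).add hf.2).mono hf.1 fun x => ?_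
  have hq : 1 ≤ p.toReal := by simpa using ENNReal.toReal_mono hp hp1
  have h0 : 0 ≤ |f x| ^ p.toReal := by positivity
  rw [abs_of_nonneg (add_nonneg zero_le_one h0)]
  rcases le_total |f x| 1 with h | h
  · linarith
  · linarith [Real.self_le_rpow_of_one_le h hq]

/-- A quantitative form of the uniform continuity of `t ↦ t^q`. -/
theorem exists_rpow_sub_rpow_le {q : ℝ} (hq : 1 ≤ q) {ε : ℝ} (hε : 0 < ε) (hε1 : ε ≤ 1) :
    ∃ C : ℝ, 0 ≤ C ∧ ∀ a b : ℝ, 0 ≤ b → b ≤ a → a ^ q - b ^ q ≤ ε * a ^ q + C * (a - b) ^ q := by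
  have hq0 : 0 < q := by linarith
  have hδ : 0 < ε / q := by positivity
  have hδ1 : ε / q ≤ 1 := (div_le_one hq0).2 (hε1.trans hq)
  refine ⟨(ε / q)⁻¹ ^ q, by positivity, fun a b hb hab => ?_⟩
  have ha : 0 ≤ a := hb.trans hab
  have hbq : 0 ≤ b ^ q := by positivity
  rcases le_total (ε / q * a) (a - b) with h | h
  · have h1 : a ≤ (ε / q)⁻¹ * (a - b) := by rwa [← div_eq_inv_mul, le_div_iff₀' hδ]
    have h2 := Real.rpow_le_rpow ha h1 hq0.le
    rw [Real.mul_rpow (by positivity) (by linarith)] at h2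
    have h3 : 0 ≤ ε * a ^ q := by positivity
    linarith
  · have h1 : (1 + -(ε / q)) * a ≤ b := by linarith
    have h2 := Real.rpow_le_rpow (mul_nonneg (by linarith) ha) h1 hq0.le
    rw [Real.mul_rpow (by linarith) ha] at h2
    have h3 := one_add_mul_self_le_rpow_one_add (s := -(ε / q)) (by linarith) hq
    have h4 : q * -(ε / q) = -ε := by field_simp
    rw [h4] at h3
    have h5 := mul_le_mul_of_nonneg_right h3 (Real.rpow_nonneg ha q)
    have h6 : 0 ≤ (ε / q)⁻¹ ^ q * (a - b) ^ q :=
      mul_nonneg (by positivity) (Real.rpow_nonneg (by linarith) q)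
    linarith

theorem lpNormVec_le_iff (hp1 : 1 ≤ p) (hp : p ≠ ∞) {f : α → ℝ} {B : ℝ≥0∞} :
    lpNormVec m p f ≤ B ↔ l1Norm m (fun x => |f x| ^ p.toReal) ≤ B ^ p.toReal := by
  have hq : 0 < p.toReal := ENNReal.toReal_pos (one_pos.trans_le hp1).ne' hp
  rw [lpNormVec, one_div, ENNReal.rpow_inv_le_iff hq]

theorem lpNormVec_rpow (hp1 : 1 ≤ p) (hp : p ≠ ∞) (f : α → ℝ) :
    lpNormVec m p f ^ p.toReal = l1Norm m (fun x => |f x| ^ p.toReal) := by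
  have hq : 0 < p.toReal := ENNReal.toReal_pos (one_pos.trans_le hp1).ne' hp
  rw [lpNormVec, ← ENNReal.rpow_mul, one_div_mul_cancel hq.ne', ENNReal.rpow_one]

/-- `L^p(m)` is closed under limits in its norm. -/
theorem memLpVec_of_tendsto [CompleteSpace E] (hp1 : 1 ≤ p) (hp : p ≠ ∞) {f : α → ℝ}
    {g : ℕ → α → ℝ} (hf : Measurable f) (hg : ∀ n, MemLpVec m p (g n))
    (h : Tendsto (fun n => lpNormVec m p (fun x => f x - g n x)) atTop (𝓝 0)) :
    MemLpVec m p f := by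
  have hq : 1 ≤ p.toReal := by simpa using ENNReal.toReal_mono hp hp1
  have hq0 : 0 < p.toReal := by linarith
  set q := p.toReal with hqdef
  have h' : Tendsto (fun n => l1Norm m (fun x => |f x - g n x| ^ q)) atTop (𝓝 0) := by
    have := (ENNReal.continuous_rpow_const (y := q)).tendsto 0 |>.comp h
    rw [ENNReal.zero_rpow_of_pos hq0] at this
    exact this.congr fun n => lpNormVec_rpow hp1 hp _
  have hgm : ∀ n, Measurable (g n) := fun n => (hg n).1
  have hfin : l1Norm m (fun x => |f x| ^ q) < ∞ := by
    obtain ⟨n, hn⟩ := ((tendsto_order.1 h').2 1 one_pos).exists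
    have hgn := hgm n
    have h1 : l1Norm m (fun x => |f x| ^ q) ≤
        l1Norm m (fun x => 2 ^ q * (|f x - g n x| ^ q + |g n x| ^ q)) := l1Norm_mono fun x => by
      refine abs_le_abs_of_nonneg (by positivity) ?_
      simpa using abs_add_rpow_le (f x - g n x) (g n x) hq0.le
    refine h1.trans_lt ?_
    rw [l1Norm_const_mul _ (by fun_prop)]
    refine ENNReal.mul_lt_top enorm_lt_top ((l1Norm_add_le (by fun_prop)).trans_lt ?_)
    exact ENNReal.add_lt_top.2 ⟨hn.trans ENNReal.one_lt_top, (hg n).2.l1Norm_lt_top⟩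
  refine ⟨hf, memL1_of_forall_exists (by fun_prop) fun ε hε => ?_⟩
  have hlim : Tendsto (fun t : ℝ => ENNReal.ofReal t * l1Norm m (fun x => |f x| ^ q)) (𝓝[>] 0)
      (𝓝 0) := by
    have h1 : Tendsto (fun t : ℝ => ENNReal.ofReal t) (𝓝[>] 0) (𝓝 0) := by
      simpa using (ENNReal.continuous_ofReal.tendsto 0).mono_left nhdsWithin_le_nhds
    simpa using ENNReal.Tendsto.mul_const h1 (Or.inr hfin.ne)
  obtain ⟨t, ht, ht0, ht1⟩ := ((((tendsto_order.1 hlim).2 (ε / 2) (ENNReal.half_pos hε.ne')).and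
    (Ioc_mem_nhdsGT one_pos)).exists)
  obtain ⟨C, hC0, hC⟩ := exists_rpow_sub_rpow_le hq ht0 ht1
  have hlim2 := ENNReal.Tendsto.const_mul (a := ENNReal.ofReal C) h' (Or.inr ENNReal.ofReal_ne_top)
  rw [mul_zero] at hlim2
  obtain ⟨n, hn⟩ := ((tendsto_order.1 hlim2).2 (ε / 2) (ENNReal.half_pos hε.ne')).exists
  have hgn := hgm n
  refine ⟨fun x => (min |f x| |g n x|) ^ q, (hg n).2.mono (by fun_prop) fun x => ?_, ?_⟩
  · refine abs_le_abs_of_nonneg (by positivity) ?_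
    exact Real.rpow_le_rpow (by positivity) (min_le_right _ _) hq0.le
  · have h1 : l1Norm m (fun x => (min |f x| |g n x|) ^ q - |f x| ^ q) ≤
        l1Norm m (fun x => t * |f x| ^ q + C * |f x - g n x| ^ q) := l1Norm_mono fun x => by
      have h2 := hC |f x| (min |f x| |g n x|) (by positivity) (min_le_left _ _)
      have h3 : (min |f x| |g n x|) ^ q ≤ |f x| ^ q :=
        Real.rpow_le_rpow (by positivity) (min_le_left _ _) hq0.le
      have h4 : |f x| - min |f x| |g n x| ≤ |f x - g n x| := by
        rcases min_cases |f x| |g n x| with h | h <;> rw [h.1]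
        · simp
        · exact abs_sub_abs_le_abs_sub _ _
      have h5 : (|f x| - min |f x| |g n x|) ^ q ≤ |f x - g n x| ^ q :=
        Real.rpow_le_rpow (sub_nonneg.2 (min_le_left _ _)) h4 hq0.le
      rw [abs_sub_comm]
      refine abs_le_abs_of_nonneg (sub_nonneg.2 h3) ?_
      exact h2.trans (by gcongr)
    refine h1.trans ((l1Norm_add_le (by fun_prop)).trans ?_)
    rw [l1Norm_const_mul _ (by fun_prop), l1Norm_const_mul _ (by fun_prop),
      Real.enorm_of_nonneg ht0.le, Real.enorm_of_nonneg hC0]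
    exact (add_le_add ht.le hn.le).trans_eq (ENNReal.add_halves ε)

end LpVec

section WeightMeasure

variable {Ω : Type*} [MeasurableSpace Ω] {μ : Measure Ω} {V : Set (Lp ℝ 1 μ)}
  (hV0 : ∀ v ∈ V, 0 ≤ v) (hV : RelWeaklyCompact V)

theorem norm_evalCLM_le (v : V) : ‖lp.evalCLM ℝ (fun _ : V => ℝ) ∞ v‖ ≤ 1 :=
  ContinuousLinearMap.opNorm_le_bound _ zero_le_one fun y => by
    rw [one_mul]
    exact lp.norm_apply_le_norm (by simp) y v

theorem weighted_real (v : Lp ℝ 1 μ) (h0 : 0 ≤ v) {A : Set Ω} (hA : MeasurableSet A) :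
    (weighted μ v).real A = ∫ x in A, v x ∂μ := by
  rw [measureReal_def, weighted, withDensity_apply _ hA,
    integral_eq_lintegral_of_nonneg_ae (ae_restrict_of_ae ((Lp.coeFn_nonneg v).2 h0))
      (Lp.aestronglyMeasurable v).restrict]

theorem toJordanDecomposition_coord (v : V) :
    (scalarMeasure (weightMeasure V hV0 hV) (lp.evalCLM ℝ (fun _ : V => ℝ) ∞ v)).toJordanDecomposition
      = @JordanDecomposition.mk _ _ (weighted μ v) 0 (isFiniteMeasure_weighted _) inferInstance
        Measure.MutuallySingular.zero_right := by
  have := isFiniteMeasure_weighted (v : Lp ℝ 1 μ)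
  refine SignedMeasure.toJordanDecomposition_eq ?_
  ext A hA
  rw [JordanDecomposition.toSignedMeasure, Measure.toSignedMeasure_zero, sub_zero,
    Measure.toSignedMeasure_apply_measurable hA, weighted_real _ (hV0 v v.2) hA, scalarMeasure_apply]
  change (weightMeasure V hV0 hV A : V → ℝ) v = _
  have h1 : weightMeasure V hV0 hV A = weightVec hV A := if_pos hA
  rw [h1]
  rfl

theorem totalVariation_coord (v : V) :
    (scalarMeasure (weightMeasure V hV0 hV) (lp.evalCLM ℝ (fun _ : V => ℝ) ∞ v)).totalVariation =
      weighted μ v := by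
  rw [SignedMeasure.totalVariation, toJordanDecomposition_coord]
  exact add_zero _

theorem lintegral_weighted_le_l1Norm (v : V) (f : Ω → ℝ) :
    ∫⁻ x, ‖f x‖ₑ ∂weighted μ v ≤ l1Norm (weightMeasure V hV0 hV) f := by
  rw [← totalVariation_coord hV0 hV v]
  exact lintegral_le_l1Norm _ f (norm_evalCLM_le v)

/-- `‖f‖_{L¹(m_V)} ≤ sup_v ∫ |f| v dμ`. -/
theorem l1Norm_weightMeasure_le {f : Ω → ℝ} {B : ℝ≥0∞}
    (h : ∀ v : V, ∫⁻ x, ‖f x‖ₑ ∂weighted μ v ≤ B) : l1Norm (weightMeasure V hV0 hV) f ≤ B := by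
  by_cases hB : B = ∞
  · simp [hB]
  refine l1Norm_le_of_simpleFunc fun s hs0 hsf => iSup₂_le fun φ hφ => ?_
  obtain ⟨Q, hQ, h1⟩ := exists_signedIntegral_signs (scalarMeasure (weightMeasure V hV0 hV) φ)
    s.measurable ((memL1_simpleFunc s).2.1 φ)
  set t : SimpleFunc Ω ℝ := SimpleFunc.piecewise Q hQ s (-s) with ht
  have h2 : (fun x => Q.indicator s x - Qᶜ.indicator s x) = t := by
    ext x
    by_cases hx : x ∈ Q <;> simp [ht, hx]
  have h3 : ∀ x, ‖t x‖ₑ ≤ ‖f x‖ₑ := fun x => by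
    rw [enorm_le_iff_norm_le]
    refine le_trans (le_of_eq ?_) (hsf x)
    by_cases hx : x ∈ Q <;> simp [ht, hx, abs_of_nonneg (hs0 x)]
  obtain ⟨y, hy⟩ := (memL1_simpleFunc (m := weightMeasure V hV0 hV) t).2.2 univ MeasurableSet.univ
  have h4 : ‖y‖ ≤ B.toReal := by
    refine lp.norm_le_of_forall_le ENNReal.toReal_nonneg fun v => ?_
    have h5 := hy (lp.evalCLM ℝ (fun _ : V => ℝ) ∞ v)
    change y v = _ at h5
    rw [h5, ← toReal_enorm]
    refine ENNReal.toReal_mono hB ((enorm_signedIntegral_le _ _ _).trans ?_)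
    rw [totalVariation_coord]
    exact (lintegral_mono h3).trans (h v)
  rw [h1, h2, ← hy]
  refine ENNReal.ofReal_le_of_le_toReal ((le_abs_self _).trans ((φ.le_of_opNorm_le hφ y).trans ?_))
  rwa [one_mul]

variable {p : ℝ≥0∞}

theorem eLpNorm_le_lpNormVec (hp1 : 1 ≤ p) (hp : p ≠ ∞) (v : V) (f : Ω → ℝ) :
    eLpNorm f p (weighted μ v) ≤ lpNormVec (weightMeasure V hV0 hV) p f := by
  have hq : 0 < p.toReal := ENNReal.toReal_pos (one_pos.trans_le hp1).ne' hp
  rw [← ENNReal.rpow_le_rpow_iff hq, ← lintegral_abs_rpow hp1 hp, lpNormVec_rpow hp1 hp]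
  exact lintegral_weighted_le_l1Norm hV0 hV v _

theorem lpNormVec_weightMeasure_le (hp1 : 1 ≤ p) (hp : p ≠ ∞) {f : Ω → ℝ} {B : ℝ≥0∞}
    (h : ∀ v : V, eLpNorm f p (weighted μ v) ≤ B) :
    lpNormVec (weightMeasure V hV0 hV) p f ≤ B := by
  rw [lpNormVec_le_iff hp1 hp]
  refine l1Norm_weightMeasure_le hV0 hV fun v => ?_
  rw [lintegral_abs_rpow hp1 hp]
  exact ENNReal.rpow_le_rpow (h v) ENNReal.toReal_nonneg

theorem eqModNull_of_ae {f g : Ω → ℝ} (hf : Measurable f) (hg : Measurable g)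
    (h : ∀ v : V, f =ᵐ[weighted μ v] g) : EqModNull (weightMeasure V hV0 hV) f g := by
  refine ⟨{x | f x = g x}ᶜ, (measurableSet_eq_fun hf hg).compl, fun B hB hBm => ?_, fun x hx => ?_⟩
  · have h1 : weightMeasure V hV0 hV B = weightVec hV B := if_pos hBm
    rw [h1]
    ext v
    change ∫ x in B, (v : Lp ℝ 1 μ) x ∂μ = 0
    rw [← weighted_real _ (hV0 v v.2) hBm, measureReal_def, measure_mono_null hB (h v)]
    rfl
  · simpa using hx

theorem EqModNull.ae {f g : Ω → ℝ} (h : EqModNull (weightMeasure V hV0 hV) f g) (v : V) :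
    f =ᵐ[weighted μ v] g := by
  obtain ⟨N, hN, hB, hfg⟩ := h
  have := isFiniteMeasure_weighted (v : Lp ℝ 1 μ)
  have h0 : weighted μ v N = 0 := by
    have h1 : weightMeasure V hV0 hV N = weightVec hV N := if_pos hN
    have h2 := hB N subset_rfl hN
    rw [h1] at h2
    have h3 : (weightVec hV N : V → ℝ) v = 0 := by rw [h2]; rfl
    change ∫ x in N, (v : Lp ℝ 1 μ) x ∂μ = 0 at h3
    rwa [← weighted_real _ (hV0 v v.2) hN, measureReal_eq_zero_iff] at h3
  filter_upwards [measure_eq_zero_iff_ae_notMem.1 h0] with x hx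
  exact hfg x hx

theorem MemLpVec.congr_weighted {f g : Ω → ℝ} (hf : MemLpVec (weightMeasure V hV0 hV) p f)
    (hg : Measurable g) (h : ∀ v : V, f =ᵐ[weighted μ v] g) :
    MemLpVec (weightMeasure V hV0 hV) p g := by
  refine ⟨hg, hf.2.of_l1Norm_sub_eq_zero (by fun_prop) (le_antisymm ?_ zero_le)⟩
  refine l1Norm_weightMeasure_le hV0 hV fun v => le_of_eq ?_
  refine (lintegral_congr_ae ?_).trans lintegral_zero
  filter_upwards [h v] with x hx
  simp [hx]

variable [Fact (1 ≤ p)]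

/-- `L^p(m_V)` as a subspace of the space of bounded families. -/
noncomputable def lpRange (p : ℝ≥0∞) [Fact (1 ≤ p)] : Submodule ℝ (RangeSpace p V) where
  carrier := {y | ∃ h : Ω →ₘ[μ] ℝ, MemLpVec (weightMeasure V hV0 hV) p h ∧
    ∀ v : V, y v =ᵐ[weighted μ v] h}
  add_mem' := by
    rintro y z ⟨g, hg, hgy⟩ ⟨h, hh, hhz⟩
    refine ⟨g + h, (hg.add hh).congr_weighted hV0 hV (g + h).measurable fun v => ?_, fun v => ?_⟩
    · exact ((weighted_absolutelyContinuous _).ae_eq (AEEqFun.coeFn_add g h)).symm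
    · filter_upwards [(weighted_absolutelyContinuous _).ae_le (AEEqFun.coeFn_add g h),
        hgy v, hhz v, Lp.coeFn_add (y v) (z v)] with x h1 h2 h3 h4
      refine h4.trans ?_
      rw [h1, Pi.add_apply, Pi.add_apply, h2, h3]
  zero_mem' := by
    have h0 : ((0 : Ω →ₘ[μ] ℝ) : Ω → ℝ) =ᵐ[μ] 0 := AEEqFun.coeFn_zero
    refine ⟨0, (memLpVec_simpleFunc (0 : SimpleFunc Ω ℝ)).congr_weighted hV0 hV
      (0 : Ω →ₘ[μ] ℝ).measurable fun v => ?_, fun v => ?_⟩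
    · exact ((weighted_absolutelyContinuous _).ae_eq h0).symm
    · exact (Lp.coeFn_zero _ _ _).trans ((weighted_absolutelyContinuous _).ae_eq h0).symm
  smul_mem' := by
    rintro c y ⟨g, hg, hgy⟩
    refine ⟨c • g, (hg.const_mul c).congr_weighted hV0 hV (c • g).measurable fun v => ?_, fun v => ?_⟩
    · exact ((weighted_absolutelyContinuous _).ae_eq (AEEqFun.coeFn_smul c g)).symm
    · filter_upwards [(weighted_absolutelyContinuous _).ae_le (AEEqFun.coeFn_smul c g),
        hgy v, Lp.coeFn_smul c (y v)] with x h1 h2 h4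
      refine h4.trans ?_
      rw [h1, Pi.smul_apply, Pi.smul_apply, h2]

theorem isClosed_lpRange (hp : p ≠ ∞) :
    IsClosed (lpRange hV0 hV p : Set (RangeSpace p V)) := by
  have hp1 : 1 ≤ p := Fact.out
  refine isClosed_of_closure_subset fun y hy => ?_
  choose z hz hzy using fun n : ℕ => Metric.mem_closure_iff.1 hy ((1 / 2 : ℝ) ^ n) (by positivity)
  choose h hh hhz using hz
  have hsub : ∀ n (v : V), ‖z n v - y v‖ₑ < ENNReal.ofReal ((1 / 2 : ℝ) ^ n) := fun n v => by
    rw [← ofReal_norm]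
    refine (ENNReal.ofReal_lt_ofReal_iff (by positivity)).2 (lt_of_le_of_lt ?_ (hzy n))
    rw [dist_comm, dist_eq_norm]
    exact lp.norm_apply_le_norm (by simp) (z n - y) v
  have hL : ∀ n (v : V), eLpNorm ((h n : Ω → ℝ) - (y v : Ω → ℝ)) p (weighted μ v) <
      ENNReal.ofReal ((1 / 2 : ℝ) ^ n) := fun n v => by
    refine lt_of_eq_of_lt ?_ (hsub n v)
    rw [Lp.enorm_def]
    refine eLpNorm_congr_ae ?_
    filter_upwards [hhz n v, Lp.coeFn_sub (z n v) (y v)] with x h1 h2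
    rw [h2, Pi.sub_apply, Pi.sub_apply, h1]
  have hmeas : ∀ n, Measurable (h n) := fun n => (h n).measurable
  set g : Ω → ℝ := fun x => limsup (fun n => h n x) atTop with hg
  have hgm : Measurable g := Measurable.limsup hmeas
  have hgy : ∀ v : V, g =ᵐ[weighted μ v] y v := fun v => by
    have hae : ∀ n, AEStronglyMeasurable (h n) (weighted μ v) := fun n =>
      (hmeas n).aestronglyMeasurable
    have hyae : AEStronglyMeasurable (y v) (weighted μ v) := Lp.aestronglyMeasurable _
    have hsum : ∑' n, (ENNReal.ofReal ((1 / 2 : ℝ) ^ n) + ENNReal.ofReal ((1 / 2 : ℝ) ^ n)) ≠ ∞ := by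
      rw [ENNReal.tsum_add, ← ENNReal.ofReal_tsum_of_nonneg (fun n => by positivity)
        summable_geometric_two]
      exact ENNReal.add_ne_top.2 ⟨ENNReal.ofReal_ne_top, ENNReal.ofReal_ne_top⟩
    have hanti : ∀ {N n : ℕ}, N ≤ n →
        ENNReal.ofReal ((1 / 2 : ℝ) ^ n) ≤ ENNReal.ofReal ((1 / 2 : ℝ) ^ N) := fun hNn =>
      ENNReal.ofReal_le_ofReal (pow_le_pow_of_le_one (by norm_num) (by norm_num) hNn)
    have hconv := Lp.ae_tendsto_of_cauchy_eLpNorm hae hp1 hsum fun N n k hn hk => by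
      have h1 : (h n : Ω → ℝ) - (h k : Ω → ℝ) =
          ((h n : Ω → ℝ) - (y v : Ω → ℝ)) - ((h k : Ω → ℝ) - (y v : Ω → ℝ)) := by
        abel
      rw [h1]
      exact (eLpNorm_sub_le ((hae n).sub hyae) ((hae k).sub hyae) hp1).trans_lt
        (ENNReal.add_lt_add ((hL n v).trans_le (hanti hn)) ((hL k v).trans_le (hanti hk)))
    have hlim : Tendsto (fun n => eLpNorm ((h n : Ω → ℝ) - (y v : Ω → ℝ)) p (weighted μ v)) atTop
        (𝓝 0) := by
      refine tendsto_of_tendsto_of_tendsto_of_le_of_le tendsto_const_nhds ?_ (fun _ => zero_le)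
        fun n => (hL n v).le
      simpa using ENNReal.tendsto_ofReal (tendsto_pow_atTop_nhds_zero_of_lt_one
        (r := (1 / 2 : ℝ)) (by norm_num) (by norm_num))
    obtain ⟨ns, hns, hsubseq⟩ := (tendstoInMeasure_of_tendsto_eLpNorm
      (one_pos.trans_le hp1).ne' hae hyae hlim).exists_seq_tendsto_ae
    filter_upwards [hconv, hsubseq] with x ⟨l, hl⟩ h2
    have h3 : l = (y v : Ω → ℝ) x := tendsto_nhds_unique (hl.comp hns.tendsto_atTop) h2
    rw [hg, ← h3]
    exact hl.limsup_eq
  refine ⟨AEEqFun.mk g hgm.aestronglyMeasurable, ?_, fun v => (hgy v).symm.trans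
    ((weighted_absolutelyContinuous _).ae_eq (AEEqFun.coeFn_mk _ _)).symm⟩
  refine MemLpVec.congr_weighted hV0 hV (f := g) ?_ (AEEqFun.measurable _) fun v =>
    ((weighted_absolutelyContinuous _).ae_eq (AEEqFun.coeFn_mk _ _)).symm
  refine memLpVec_of_tendsto hp1 hp hgm hh (tendsto_of_tendsto_of_tendsto_of_le_of_le
    tendsto_const_nhds (?_ : Tendsto (fun n => ENNReal.ofReal ((1 / 2 : ℝ) ^ n)) _ _)
    (fun _ => zero_le) fun n => lpNormVec_weightMeasure_le hV0 hV hp1 hp fun v => ?_)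
  · simpa using ENNReal.tendsto_ofReal (tendsto_pow_atTop_nhds_zero_of_lt_one
      (r := (1 / 2 : ℝ)) (by norm_num) (by norm_num))
  · refine le_trans (le_of_eq ?_) (hL n v).le
    rw [← eLpNorm_neg]
    refine eLpNorm_congr_ae ?_
    filter_upwards [hgy v] with x hx
    simp [hx]

end WeightMeasure

end ConjWeights

namespace ConjWeights

section Separation

variable {α : Type*} [MeasurableSpace α]

/-- The simple function `|s|^q`. -/
noncomputable def simpleAbsPow (q : ℝ) (s : SimpleFunc α ℝ) : SimpleFunc α ℝ := s.map fun x => |x| ^ q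

@[simp]
theorem simpleAbsPow_apply (q : ℝ) (s : SimpleFunc α ℝ) (x : α) :
    simpleAbsPow q s x = |s x| ^ q := rfl

theorem simpleAbsPow_nonneg (q : ℝ) (s : SimpleFunc α ℝ) : 0 ≤ simpleAbsPow q s :=
  fun _ => Real.rpow_nonneg (abs_nonneg _) _

theorem simpleFunc_sum_apply {ι : Type*} (t : Finset ι) (f : ι → SimpleFunc α ℝ) (x : α) :
    (∑ i ∈ t, f i) x = ∑ i ∈ t, f i x := by
  classical
  induction t using Finset.induction_on with
  | empty => simp
  | insert i t hi ih => simp [Finset.sum_insert hi, ih]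

/-- The cone used to separate a `p`-convex functional from a `p`-regular one. -/
noncomputable def separationCone {q : ℝ} (hq : 0 < q) (N t : SimpleFunc α ℝ → ℝ)
    (hNadd : ∀ f g, N (f + g) ≤ N f + N g) (hNsmul : ∀ c : ℝ, 0 ≤ c → ∀ f, N (c • f) = c * N f)
    (hNmono : ∀ f g, 0 ≤ f → f ≤ g → N f ≤ N g)
    (htsmul : ∀ c : ℝ, 0 ≤ c → ∀ f, t (c • f) = c ^ q * t f) :
    PointedCone ℝ (SimpleFunc α ℝ × ℝ) where
  carrier := {z | ∃ (n : ℕ) (f : Fin n → SimpleFunc α ℝ),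
    N ((z.1 + ∑ i, simpleAbsPow q (f i)) ⊔ 0) - ∑ i, t (f i) ≤ z.2}
  zero_mem' := by
    refine ⟨0, Fin.elim0, ?_⟩
    have h0 : N 0 = 0 := by simpa using hNsmul 0 le_rfl 0
    simp [h0]
  add_mem' := by
    rintro z z' ⟨n, f, hf⟩ ⟨n', f', hf'⟩
    refine ⟨n + n', Fin.append f f', ?_⟩
    have h1 : ∑ i, simpleAbsPow q (Fin.append f f' i) =
        ∑ i, simpleAbsPow q (f i) + ∑ i, simpleAbsPow q (f' i) := by
      rw [Fin.sum_univ_add]; simp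
    have h2 : ∑ i, t (Fin.append f f' i) = ∑ i, t (f i) + ∑ i, t (f' i) := by
      rw [Fin.sum_univ_add]; simp
    rw [h1, h2, Prod.fst_add, Prod.snd_add]
    have h3 := hNmono _ ((z.1 + ∑ i, simpleAbsPow q (f i)) ⊔ 0 +
        (z'.1 + ∑ i, simpleAbsPow q (f' i)) ⊔ 0) (le_sup_right (a := z.1 + z'.1 +
        (∑ i, simpleAbsPow q (f i) + ∑ i, simpleAbsPow q (f' i))))
      (sup_le (by
        rw [add_add_add_comm]
        exact add_le_add le_sup_left le_sup_left) (add_nonneg le_sup_right le_sup_right))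
    linarith [hNadd ((z.1 + ∑ i, simpleAbsPow q (f i)) ⊔ 0)
      ((z'.1 + ∑ i, simpleAbsPow q (f' i)) ⊔ 0)]
  smul_mem' := by
    rintro ⟨c, hc⟩ z ⟨n, f, hf⟩
    refine ⟨n, fun i => c ^ q⁻¹ • f i, ?_⟩
    have hcq : (c ^ q⁻¹) ^ q = c := Real.rpow_inv_rpow hc hq.ne'
    have hc' : 0 ≤ c ^ q⁻¹ := Real.rpow_nonneg hc _
    have h1 : ∀ i, simpleAbsPow q (c ^ q⁻¹ • f i) = c • simpleAbsPow q (f i) := fun i => by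
      ext x
      simp only [simpleAbsPow_apply, SimpleFunc.coe_smul, Pi.smul_apply, smul_eq_mul, abs_mul,
        abs_of_nonneg hc']
      rw [Real.mul_rpow hc' (abs_nonneg _), hcq]
    simp_rw [h1, htsmul _ hc', hcq, ← Finset.mul_sum, ← Finset.smul_sum]
    have h2 : ((⟨c, hc⟩ : {c : ℝ // 0 ≤ c}) • z).1 = c • z.1 := rfl
    have h3 : ((⟨c, hc⟩ : {c : ℝ // 0 ≤ c}) • z).2 = c * z.2 := rfl
    have h4 : (c • z.1 + c • ∑ i, simpleAbsPow q (f i)) ⊔ 0 =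
        c • ((z.1 + ∑ i, simpleAbsPow q (f i)) ⊔ 0) := by
      ext x
      simp only [SimpleFunc.coe_sup, SimpleFunc.coe_add, SimpleFunc.coe_smul, Pi.sup_apply,
        Pi.add_apply, Pi.smul_apply, smul_eq_mul, SimpleFunc.coe_zero, Pi.zero_apply]
      rw [← mul_add]
      rw [mul_max_of_nonneg _ _ hc, mul_zero]
    rw [h2, h3, h4, hNsmul c hc, ← mul_sub]
    exact mul_le_mul_of_nonneg_left hf hc

theorem exists_linear_of_regular {q : ℝ} (hq : 0 < q) (N t : SimpleFunc α ℝ → ℝ)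
    (hNadd : ∀ f g, N (f + g) ≤ N f + N g) (hNsmul : ∀ c : ℝ, 0 ≤ c → ∀ f, N (c • f) = c * N f)
    (hNmono : ∀ f g, 0 ≤ f → f ≤ g → N f ≤ N g)
    (htsmul : ∀ c : ℝ, 0 ≤ c → ∀ f, t (c • f) = c ^ q * t f)
    (hreg : ∀ (n : ℕ) (f : Fin n → SimpleFunc α ℝ),
      ∑ i, t (f i) ≤ N (∑ i, simpleAbsPow q (f i))) :
    ∃ φ : SimpleFunc α ℝ →ₗ[ℝ] ℝ, (∀ f, φ f ≤ N (f ⊔ 0)) ∧ ∀ f, t f ≤ φ (simpleAbsPow q f) := by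
  set s := separationCone hq N t hNadd hNsmul hNmono htsmul
  have h0 : N 0 = 0 := by simpa using hNsmul 0 le_rfl 0
  let F : (SimpleFunc α ℝ × ℝ) →ₗ.[ℝ] ℝ :=
    ⟨(⊥ : Submodule ℝ (SimpleFunc α ℝ)).prod ⊤, (LinearMap.snd ℝ _ _).comp (Submodule.subtype _)⟩
  obtain ⟨G, hG1, hG2⟩ := riesz_extension s F (by
    rintro ⟨⟨h, r⟩, hh, _⟩ ⟨n, f, hf⟩
    obtain rfl : h = 0 := by simpa using hh
    change 0 ≤ r
    have h1 : (0 + ∑ i, simpleAbsPow q (f i)) ⊔ 0 = ∑ i, simpleAbsPow q (f i) := by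
      rw [zero_add]
      exact sup_eq_left.2 (Finset.sum_nonneg fun i _ => simpleAbsPow_nonneg q (f i))
    change N ((0 + ∑ i, simpleAbsPow q (f i)) ⊔ 0) - ∑ i, t (f i) ≤ r at hf
    rw [h1] at hf
    linarith [hreg n f]) (by
    rintro ⟨h, r⟩
    refine ⟨⟨(0, N (h ⊔ 0) - r), by simp [F]⟩, 0, Fin.elim0, ?_⟩
    simp)
  have hG3 : ∀ r : ℝ, G (0, r) = r := fun r => hG1 ⟨(0, r), by simp [F]⟩
  have hG4 : ∀ h r, (h, r) ∈ s → -G (h, 0) ≤ r := fun h r hs => by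
    have h1 := hG2 _ hs
    have h2 : ((h, r) : SimpleFunc α ℝ × ℝ) = (h, 0) + (0, r) := by simp
    rw [h2, map_add, hG3] at h1
    linarith
  refine ⟨-(G.comp (LinearMap.inl ℝ _ _)), fun f => ?_, fun f => ?_⟩
  · refine hG4 f _ ⟨0, Fin.elim0, ?_⟩
    simp
  · have h1 := hG4 (-simpleAbsPow q f) (-t f) ⟨1, fun _ => f, by simp [h0]⟩
    have h2 : ((-simpleAbsPow q f, 0) : SimpleFunc α ℝ × ℝ) = -(simpleAbsPow q f, 0) := by simp
    rw [h2, map_neg, neg_neg] at h1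
    change t f ≤ -G (simpleAbsPow q f, 0)
    linarith

theorem indSimple_apply {A : Set α} (hA : MeasurableSet A) (x : α) :
    indSimple A hA x = A.indicator (fun _ => 1) x := by
  by_cases hx : x ∈ A <;> simp [indSimple, hx]

/-- A positive linear functional on simple functions that is continuous along decreasing sequences
of sets is the integral against a finite measure. -/
theorem exists_measure_of_linear (φ : SimpleFunc α ℝ →ₗ[ℝ] ℝ) (hpos : ∀ s, 0 ≤ s → 0 ≤ φ s)
    (hcont : ∀ (B : ℕ → Set α) (hB : ∀ n, MeasurableSet (B n)), Antitone B → ⋂ n, B n = ∅ →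
      Tendsto (fun n => φ (indSimple (B n) (hB n))) atTop (𝓝 0)) :
    ∃ κ : Measure α, IsFiniteMeasure κ ∧ ∀ s : SimpleFunc α ℝ, ∫ x, s x ∂κ = φ s := by
  have hind0 : ∀ {A : Set α} (hA : MeasurableSet A), 0 ≤ φ (indSimple A hA) := fun hA =>
    hpos _ fun x => by
      rw [indSimple_apply]
      exact indicator_nonneg (fun _ _ => zero_le_one) x
  have hunion : ∀ {A B : Set α} (hA : MeasurableSet A) (hB : MeasurableSet B), Disjoint A B →
      φ (indSimple (A ∪ B) (hA.union hB)) = φ (indSimple A hA) + φ (indSimple B hB) :=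
    fun hA hB hd => by
      rw [← map_add]
      congr 1
      ext x
      rw [SimpleFunc.coe_add, Pi.add_apply, indSimple_apply, indSimple_apply, indSimple_apply,
        indicator_union_of_disjoint hd]
  have hempty : φ (indSimple ∅ MeasurableSet.empty) = 0 := by
    have := hunion MeasurableSet.empty (MeasurableSet.empty (α := α)) (disjoint_empty _)
    simpa using this
  have hsum : ∀ (A : ℕ → Set α) (hA : ∀ i, MeasurableSet (A i)),
      Pairwise (Function.onFun Disjoint A) →
      HasSum (fun i => φ (indSimple (A i) (hA i)))
        (φ (indSimple (⋃ i, A i) (MeasurableSet.iUnion hA))) := by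
    intro A hA hd
    rw [hasSum_iff_tendsto_nat_of_nonneg fun i => hind0 (hA i)]
    have hm : ∀ n, MeasurableSet (⋃ i ∈ Finset.range n, A i) := fun n =>
      (Finset.range n).measurableSet_biUnion fun i _ => hA i
    have hfin : ∀ n, ∑ i ∈ Finset.range n, φ (indSimple (A i) (hA i)) =
        φ (indSimple (⋃ i ∈ Finset.range n, A i) (hm n)) := by
      intro n
      induction n with
      | zero => simp [hempty]
      | succ n ih =>
        rw [Finset.sum_range_succ, ih, ← hunion (hm n) (hA n)]
        · congr 2
          rw [Finset.range_add_one, Finset.set_biUnion_insert, union_comm]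
        · refine disjoint_iUnion₂_left.2 fun i hi => hd ?_
          exact (Finset.mem_range.1 hi).ne
    have hD : ∀ n, MeasurableSet ((⋃ i, A i) \ ⋃ i ∈ Finset.range n, A i) := fun n =>
      (MeasurableSet.iUnion hA).diff (hm n)
    have hsplit : ∀ n, φ (indSimple (⋃ i, A i) (MeasurableSet.iUnion hA)) -
        φ (indSimple ((⋃ i, A i) \ ⋃ i ∈ Finset.range n, A i) (hD n)) =
        ∑ i ∈ Finset.range n, φ (indSimple (A i) (hA i)) := fun n => by
      rw [hfin, sub_eq_iff_eq_add, ← hunion (hm n) (hD n) disjoint_sdiff_right]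
      congr 2
      rw [union_sdiff_cancel]
      exact iUnion₂_subset fun i _ => subset_iUnion A i
    have hlim := hcont _ hD (fun i j hij => sdiff_subset_sdiff_right
      (biUnion_subset_biUnion_left fun k hk => by
        simp only [Finset.coe_range, mem_Iio] at hk ⊢
        lia)) (by
      rw [← sdiff_iUnion, sdiff_eq_empty]
      intro x hx
      obtain ⟨i, hi⟩ := mem_iUnion.1 hx
      exact mem_iUnion.2 ⟨i + 1, mem_iUnion₂.2 ⟨i, by simp, hi⟩⟩)
    have := hlim.const_sub (φ (indSimple (⋃ i, A i) (MeasurableSet.iUnion hA)))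
    rw [sub_zero] at this
    exact this.congr hsplit
  let κ : Measure α := Measure.ofMeasurable
    (fun A hA => ENNReal.ofReal (φ (indSimple A hA))) (by rw [hempty, ENNReal.ofReal_zero])
    (fun A hA hd => by
      rw [← (hsum A hA hd).tsum_eq,
        ENNReal.ofReal_tsum_of_nonneg (fun i => hind0 (hA i)) (hsum A hA hd).summable])
  have hκ : ∀ {A : Set α} (hA : MeasurableSet A), κ A = ENNReal.ofReal (φ (indSimple A hA)) :=
    fun hA => Measure.ofMeasurable_apply _ hA
  have hfin : IsFiniteMeasure κ := ⟨by rw [hκ MeasurableSet.univ]; exact ENNReal.ofReal_lt_top⟩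
  refine ⟨κ, hfin, fun s => ?_⟩
  induction s using SimpleFunc.induction with
  | @const c B hB =>
    have h1 : SimpleFunc.piecewise B hB (SimpleFunc.const _ c) (SimpleFunc.const _ 0) =
        c • indSimple B hB := by
      ext x
      by_cases hx : x ∈ B <;> simp [indSimple, hx]
    have h2 : ∀ x, (c • indSimple B hB) x = B.indicator (fun _ => c) x := fun x => by
      rw [SimpleFunc.coe_smul, Pi.smul_apply, indSimple_apply]
      by_cases hx : x ∈ B <;> simp [hx]
    rw [h1, map_smul, integral_congr_ae (Eventually.of_forall h2), integral_indicator hB,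
      setIntegral_const, measureReal_def, hκ hB, ENNReal.toReal_ofReal (hind0 hB), smul_eq_mul,
      smul_eq_mul, mul_comm]
  | @add s t _ hs ht =>
    rw [map_add, ← hs, ← ht]
    exact integral_add (s.integrable_of_isFiniteMeasure) (t.integrable_of_isFiniteMeasure)

end Separation

end ConjWeights

namespace ConjWeights

section ToLp

variable {α : Type*} [MeasurableSpace α] {ν κ : Measure α} {X : BanachFunctionSpace ν} {p : ℝ≥0∞}

theorem memLp_of_eLpNorm_le {f : α →ₘ[ν] ℝ} {B : ℝ≥0∞} (hκ : κ ≪ ν)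
    (h : eLpNorm f p κ ≤ B) (hB : B < ∞) : MemLp f p κ :=
  ⟨f.aestronglyMeasurable.mono_ac hκ, h.trans_lt hB⟩

/-- The canonical map of a Banach function space into `L^p(κ)`. -/
noncomputable def toLpLin (hκ : κ ≪ ν) (h : ∀ f : X.carrier, MemLp (f : α →ₘ[ν] ℝ) p κ) :
    X.carrier →ₗ[ℝ] Lp ℝ p κ where
  toFun f := (h f).toLp _
  map_add' f g := by
    rw [← MemLp.toLp_add, MemLp.toLp_eq_toLp_iff]
    exact hκ.ae_eq (AEEqFun.coeFn_add _ _)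
  map_smul' c f := by
    rw [RingHom.id_apply, ← MemLp.toLp_const_smul, MemLp.toLp_eq_toLp_iff]
    exact hκ.ae_eq (AEEqFun.coeFn_smul _ _)

theorem coe_toLpLin (hκ : κ ≪ ν) (h : ∀ f : X.carrier, MemLp (f : α →ₘ[ν] ℝ) p κ)
    (f : X.carrier) : toLpLin hκ h f =ᵐ[κ] (f : α →ₘ[ν] ℝ) :=
  (h f).coeFn_toLp

theorem enorm_toLpLin (hκ : κ ≪ ν) (h : ∀ f : X.carrier, MemLp (f : α →ₘ[ν] ℝ) p κ)
    (f : X.carrier) : ‖toLpLin hκ h f‖ₑ = eLpNorm (f : α →ₘ[ν] ℝ) p κ :=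
  Lp.enorm_toLp (h f)

theorem denseRange_toLpLin [Fact (1 ≤ p)] (hp : p ≠ ∞) (hκ : κ ≪ ν)
    (h : ∀ f : X.carrier, MemLp (f : α →ₘ[ν] ℝ) p κ) : DenseRange (toLpLin hκ h) := by
  refine (Lp.simpleFunc.denseRange (E := ℝ) (μ := κ) (p := p) hp).mono ?_
  rintro _ ⟨s, rfl⟩
  refine ⟨X.ofSimple (Lp.simpleFunc.toSimpleFunc s), Lp.ext ?_⟩
  exact (coe_toLpLin hκ h _).trans ((hκ.ae_eq (X.coe_ofSimple _)).trans
    (Lp.simpleFunc.toSimpleFunc_eq_toFun s))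

theorem tendsto_toLpLin [Fact (1 ≤ p)] (hκ : κ ≪ ν)
    (h : ∀ f : X.carrier, MemLp (f : α →ₘ[ν] ℝ) p κ) {D : ℝ≥0}
    (hD : ∀ f : X.carrier, eLpNorm (f : α →ₘ[ν] ℝ) p κ ≤ D * ENNReal.ofReal (X.norm f))
    {f : X.carrier} {g : ℕ → X.carrier}
    (hg : Tendsto (fun n => X.norm (f - g n)) atTop (𝓝 0)) :
    Tendsto (fun n => toLpLin hκ h (g n)) atTop (𝓝 (toLpLin hκ h f)) := by
  rw [tendsto_iff_edist_tendsto_0]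
  have h1 := ENNReal.Tendsto.const_mul (a := (D : ℝ≥0∞)) (ENNReal.tendsto_ofReal hg)
    (Or.inr ENNReal.coe_ne_top)
  rw [ENNReal.ofReal_zero, mul_zero] at h1
  refine tendsto_of_tendsto_of_tendsto_of_le_of_le tendsto_const_nhds h1 (fun _ => zero_le)
    fun n => ?_
  rw [edist_comm, edist_eq_enorm_sub, ← map_sub, enorm_toLpLin]
  exact hD _

end ToLp

section Forward

variable {Ω₁ Ω₂ : Type*} [MeasurableSpace Ω₁] [MeasurableSpace Ω₂] {ν : Measure Ω₁}
  {μ : Measure Ω₂} {X : BanachFunctionSpace ν} {p : ℝ≥0∞} [Fact (1 ≤ p)] {V : Set (Lp ℝ 1 μ)}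
  {T : X.carrier →ₗ[ℝ] (Ω₂ →ₘ[μ] ℝ)}
  (hX : X.OrderContinuous) (hT : UniformlyBounded p V T)

theorem enorm_opLin_le {f : X.carrier} {B : ℝ≥0∞}
    (h : ∀ v : V, eLpNorm (T f) p (weighted μ v) ≤ B) : ‖opLin hT f‖ₑ ≤ B := by
  by_cases hB : B = ∞
  · simp [hB]
  rw [← ofReal_norm]
  refine ENNReal.ofReal_le_of_le_toReal (lp.norm_le_of_forall_le ENNReal.toReal_nonneg fun v => ?_)
  rw [← toReal_enorm]
  refine ENNReal.toReal_mono hB ?_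
  rw [enorm_opLin_apply]
  exact h v

/-- For a `p`-th power factorable operator, `X` is contained in `L^p(m_T)`. -/
theorem PthPowerFactorable.exists_l1Norm_rpow_le (hp : p ≠ ∞) (hV0 : ∀ v ∈ V, 0 ≤ v)
    (hV : RelWeaklyCompact V) (h : PthPowerFactorable (weightMeasure V hV0 hV) p T) :
    ∃ K : ℝ≥0, ∀ f : X.carrier,
      l1Norm (opMeasure hX hT) (fun x => |(f : Ω₁ →ₘ[ν] ℝ) x| ^ p.toReal) ≤
        K * ENNReal.ofReal (X.norm f) ^ p.toReal := by
  have hp1 : 1 ≤ p := Fact.out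
  have hq : 0 < p.toReal := ENNReal.toReal_pos (one_pos.trans_le hp1).ne' hp
  obtain ⟨K, hK⟩ := h
  refine ⟨K, fun f => l1Norm_le_of_simpleFunc fun s hs0 hsf =>
    l1Norm_opMeasure_simpleFunc_le hX hT fun t ht => enorm_opLin_le hT fun v =>
      (eLpNorm_le_lpNormVec hV0 hV hp1 hp v _).trans ((hK _).trans ?_)⟩
  gcongr
  set g : X.carrier := X.ofSimple (t.map fun x => |x| ^ (1 / p.toReal))
  have h1 : absPow (1 / p.toReal) (X.ofSimple t : Ω₁ →ₘ[ν] ℝ) = g := by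
    refine AEEqFun.ext ((AEEqFun.coeFn_compMeasurable _ _ _).trans ?_)
    filter_upwards [X.coe_ofSimple t, X.coe_ofSimple (t.map fun x => |x| ^ (1 / p.toReal))]
      with x h1 h2
    rw [h2, Function.comp_apply, h1]
    rfl
  rw [h1, BanachFunctionSpace.extNorm_coe]
  refine ENNReal.ofReal_le_ofReal (BanachFunctionSpace.norm_le_of_ae_le ?_)
  filter_upwards [X.coe_ofSimple (t.map fun x => |x| ^ (1 / p.toReal))] with x h2
  rw [h2]
  change |(|t x|) ^ (1 / p.toReal)| ≤ _
  rw [ht, abs_of_nonneg (by positivity), abs_of_nonneg (hs0 x), one_div,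
    Real.rpow_inv_le_iff_of_pos (hs0 x) (abs_nonneg _) hq]
  have := hsf x
  rwa [abs_of_nonneg (by positivity)] at this

/-- The non-negative weights `w` with `∫ |f| w dν ≤ ‖f‖_{L¹(m_T)}`. -/
def dominatedWeights : Set (Lp ℝ 1 ν) :=
  {w | 0 ≤ w ∧ ∀ f : Ω₁ → ℝ, ∫⁻ x, ‖f x‖ₑ ∂weighted ν w ≤ l1Norm (opMeasure hX hT) f}

theorem lintegral_enorm_mul_weight {w : Lp ℝ 1 ν} (h0 : 0 ≤ w) {f : Ω₁ → ℝ} (hf : Measurable f) :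
    ∫⁻ x, ‖f x * w x‖ₑ ∂ν = ∫⁻ x, ‖f x‖ₑ ∂weighted ν w := by
  rw [← lintegral_mul_weight w hf]
  refine lintegral_congr_ae ?_
  filter_upwards [(Lp.coeFn_nonneg w).2 h0] with x hx
  rw [Real.enorm_eq_ofReal_abs, abs_mul, abs_of_nonneg hx]

theorem dominatedWeights_subset_koetheBall {w : Lp ℝ 1 ν} (hw : w ∈ dominatedWeights hX hT) :
    (w : Ω₁ →ₘ[ν] ℝ) ∈
      koetheBall ν (L1Set ν (opMeasure hX hT)) (fun f => l1Norm (opMeasure hX hT) f) 1 := by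
  refine ⟨fun f hf => ⟨f.aestronglyMeasurable.mul (Lp.aestronglyMeasurable w), ?_⟩,
    iSup₂_le fun f hf => iSup_le fun hf1 => ?_⟩
  · exact ((lintegral_enorm_mul_weight hw.1 f.measurable).trans_le (hw.2 f)).trans_lt
      (MemL1.l1Norm_lt_top hf)
  · refine le_trans ?_ ((lintegral_enorm_mul_weight hw.1 f.measurable).trans_le ((hw.2 f).trans hf1))
    refine le_trans ?_ (enorm_integral_le_lintegral_enorm _)
    rw [Real.enorm_eq_ofReal_abs]
    exact ENNReal.ofReal_le_ofReal (le_abs_self _)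

theorem positivelyNorming_dominatedWeights [SigmaFinite ν] :
    PositivelyNorming (opMeasure hX hT) (dominatedWeights hX hT) := by
  refine ⟨fun w hw => ⟨hw.1, dominatedWeights_subset_koetheBall hX hT hw⟩, 1, 1, one_pos,
    fun f _ => ⟨?_, ?_⟩⟩
  · rw [ENNReal.coe_one, one_mul]
    refine iSup₂_le fun φ hφ => ?_
    obtain ⟨w, hw0, hw⟩ := exists_weight _ (opMeasure_absolutelyContinuous hX hT φ)
    rw [← hw, ← lintegral_mul_weight w f.measurable]
    refine le_iSup₂ (f := fun (w : Lp ℝ 1 ν) (_ : w ∈ dominatedWeights hX hT) =>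
      ∫⁻ x, ENNReal.ofReal (|f x| * w x) ∂ν) w ⟨hw0, fun g => ?_⟩
    rw [hw]
    exact lintegral_le_l1Norm _ g hφ
  · rw [ENNReal.coe_one, one_mul]
    refine iSup₂_le fun w hw => ?_
    rw [lintegral_mul_weight w f.measurable]
    exact hw.2 f

theorem exists_koetheBall_subset : ∃ K : ℝ≥0,
    koetheBall ν (L1Set ν (opMeasure hX hT)) (fun f => l1Norm (opMeasure hX hT) f) 1 ⊆
      koetheBall ν (X.carrier : Set (Ω₁ →ₘ[ν] ℝ)) X.extNorm K := by
  obtain ⟨C, hC⟩ := exists_l1Norm_opMeasure_le hX hT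
  refine ⟨C + 1, fun g hg => ⟨fun f hf => hg.1 f (memL1_opMeasure hX hT ⟨f, hf⟩),
    iSup₂_le fun f hf => iSup_le fun hf1 => ?_⟩⟩
  have hC1 : (0 : ℝ) < C + 1 := by positivity
  set f' : X.carrier := ((C : ℝ) + 1)⁻¹ • ⟨f, hf⟩ with hf'
  have hnorm : X.norm ⟨f, hf⟩ ≤ 1 := by
    have h1 := X.extNorm_coe ⟨f, hf⟩
    rw [h1] at hf1
    simpa using hf1
  have h1 : l1Norm (opMeasure hX hT) (f' : Ω₁ →ₘ[ν] ℝ) ≤ 1 := by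
    refine (hC f').trans ?_
    rw [hf', map_smul_eq_mul, ← ENNReal.ofReal_coe_nnreal, ← ENNReal.ofReal_mul C.coe_nonneg,
      ENNReal.ofReal_le_one, Real.norm_of_nonneg (by positivity)]
    calc (C : ℝ) * (((C : ℝ) + 1)⁻¹ * X.norm ⟨f, hf⟩) ≤ (C + 1) * (((C : ℝ) + 1)⁻¹ * 1) := by
          gcongr; linarith
      _ = 1 := by field_simp
  have h2 : ENNReal.ofReal (∫ x, (f' : Ω₁ →ₘ[ν] ℝ) x * g x ∂ν) ≤ 1 :=
    (le_iSup₂_of_le (f := fun (f : Ω₁ →ₘ[ν] ℝ) (_ : f ∈ L1Set ν (opMeasure hX hT)) =>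
      ⨆ (_ : l1Norm (opMeasure hX hT) f ≤ 1), ENNReal.ofReal (∫ x, f x * g x ∂ν))
      (f' : Ω₁ →ₘ[ν] ℝ) (memL1_opMeasure hX hT f') (le_iSup_of_le h1 le_rfl)).trans hg.2
  have h3 : ∫ x, (f' : Ω₁ →ₘ[ν] ℝ) x * g x ∂ν = ((C : ℝ) + 1)⁻¹ * ∫ x, f x * g x ∂ν := by
    rw [← integral_const_mul]
    refine integral_congr_ae ?_
    filter_upwards [AEEqFun.coeFn_smul ((C : ℝ) + 1)⁻¹ f] with x hx
    rw [← mul_assoc]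
    congr 1
  rw [h3, ENNReal.ofReal_le_one, inv_mul_le_iff₀ hC1, mul_one] at h2
  refine (ENNReal.ofReal_le_ofReal h2).trans_eq ?_
  rw [ENNReal.ofReal_add C.coe_nonneg zero_le_one]
  simp

variable {hX hT}

theorem eLpNorm_le_of_dominatedWeights (hp : p ≠ ∞) {K : ℝ≥0} (hK : ∀ f : X.carrier,
      l1Norm (opMeasure hX hT) (fun x => |(f : Ω₁ →ₘ[ν] ℝ) x| ^ p.toReal) ≤
        K * ENNReal.ofReal (X.norm f) ^ p.toReal) {w : Lp ℝ 1 ν}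
    (hw : w ∈ dominatedWeights hX hT) (f : X.carrier) :
    eLpNorm (f : Ω₁ →ₘ[ν] ℝ) p (weighted ν w) ≤
      (K ^ p.toReal⁻¹ : ℝ≥0) * ENNReal.ofReal (X.norm f) := by
  have hp1 : 1 ≤ p := Fact.out
  have hq : 0 < p.toReal := ENNReal.toReal_pos (one_pos.trans_le hp1).ne' hp
  rw [← ENNReal.rpow_le_rpow_iff hq, ← lintegral_abs_rpow hp1 hp,
    ENNReal.mul_rpow_of_nonneg _ _ hq.le, ENNReal.coe_rpow_of_nonneg _ (by positivity),
    ENNReal.rpow_inv_rpow hq.ne']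
  exact (hw.2 _).trans (hK f)

variable (hX hT)

/-- The weight that corresponds to `v`, by separation. -/
theorem exists_dominatedWeight [IsFiniteMeasure ν] (hp : p ≠ ∞) {K : ℝ≥0} (hK0 : 0 < K) (v : V)
    (hreg : ∀ (n : ℕ) (f : Fin n → SimpleFunc Ω₁ ℝ),
      ∑ i, eLpNorm (T (X.ofSimple (f i))) p (weighted μ v) ^ p.toReal ≤
        K * l1Norm (opMeasure hX hT) (∑ i, simpleAbsPow p.toReal (f i) : SimpleFunc Ω₁ ℝ)) :
    ∃ w ∈ dominatedWeights hX hT, ∀ s : SimpleFunc Ω₁ ℝ,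
      eLpNorm (T (X.ofSimple s)) p (weighted μ v) ^ p.toReal ≤
        K * eLpNorm s p (weighted ν w) ^ p.toReal := by
  have hp1 : 1 ≤ p := Fact.out
  have hq : 0 < p.toReal := ENNReal.toReal_pos (one_pos.trans_le hp1).ne' hp
  set m := opMeasure hX hT
  set q := p.toReal
  set N : SimpleFunc Ω₁ ℝ → ℝ := fun s => (l1Norm m s).toReal with hN
  have hNfin : ∀ s : SimpleFunc Ω₁ ℝ, l1Norm m s ≠ ∞ := fun s =>
    (memL1_simpleFunc s).l1Norm_lt_top.ne
  set e : SimpleFunc Ω₁ ℝ → ℝ≥0∞ := fun s => eLpNorm (T (X.ofSimple s)) p (weighted μ v) with he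
  have hefin : ∀ s, e s ≠ ∞ := fun s => (hT.memLp (X.ofSimple s) v).2.ne
  obtain ⟨φ, hφN, hφt⟩ := exists_linear_of_regular hq N (fun s => (K : ℝ)⁻¹ * (e s ^ q).toReal)
    (fun f g => by
      rw [hN]
      beta_reduce
      rw [← ENNReal.toReal_add (hNfin f) (hNfin g)]
      exact ENNReal.toReal_mono (ENNReal.add_ne_top.2 ⟨hNfin f, hNfin g⟩)
        (l1Norm_add_le f.measurable))
    (fun c hc f => by
      have h1 : l1Norm m (c • f : SimpleFunc Ω₁ ℝ) = ‖c‖ₑ * l1Norm m f :=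
        l1Norm_const_mul c f.measurable
      simp only [hN, h1, ENNReal.toReal_mul, toReal_enorm, Real.norm_of_nonneg hc])
    (fun f g hf hfg => ENNReal.toReal_mono (hNfin g) (l1Norm_mono fun x =>
      abs_le_abs_of_nonneg (hf x) (hfg x)))
    (fun c hc f => by
      have h1 : e (c • f) = ‖c‖ₑ * e f := by
        rw [he]
        beta_reduce
        rw [← enorm_opLin_apply hT, ← enorm_opLin_apply hT, map_smul, map_smul, ← enorm_smul]
        rfl
      rw [h1, ENNReal.mul_rpow_of_nonneg _ _ hq.le, ENNReal.toReal_mul, ← ENNReal.toReal_rpow,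
        toReal_enorm, Real.norm_of_nonneg hc]
      ring)
    (fun n f => by
      have hfin : ∀ i ∈ Finset.univ, e (f i) ^ q ≠ ∞ := fun i _ =>
        ENNReal.rpow_ne_top_of_nonneg hq.le (hefin _)
      rw [← Finset.mul_sum, ← ENNReal.toReal_sum hfin, inv_mul_le_iff₀ (by positivity)]
      refine (ENNReal.toReal_mono (ENNReal.mul_ne_top ENNReal.coe_ne_top (hNfin _))
        (hreg n f)).trans_eq ?_
      rw [ENNReal.toReal_mul, ENNReal.coe_toReal])
  have hφabs : ∀ s : SimpleFunc Ω₁ ℝ, 0 ≤ s → φ s ≤ N s := fun s hs => by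
    have := hφN s
    rwa [sup_eq_left.2 hs] at this
  have hN0 : N 0 = 0 := by
    have h1 : l1Norm m (0 : SimpleFunc Ω₁ ℝ) = 0 := by
      refine le_antisymm (iSup₂_le fun φ _ => ?_) zero_le
      simp
    change (l1Norm m (0 : SimpleFunc Ω₁ ℝ)).toReal = 0
    rw [h1, ENNReal.toReal_zero]
  have hφpos : ∀ s : SimpleFunc Ω₁ ℝ, 0 ≤ s → 0 ≤ φ s := fun s hs => by
    have := hφN (-s)
    rw [sup_eq_right.2 (neg_nonpos.2 hs), hN0, map_neg] at this
    linarith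
  obtain ⟨C, hC⟩ := exists_l1Norm_opMeasure_le hX hT
  obtain ⟨κ, hκfin, hκ⟩ := exists_measure_of_linear φ hφpos fun B hB hanti hinter => by
    have hlim := hX (fun n => X.ind (B n) (hB n)) (fun i j hij => chi_mono (hB j) (hB i) (hanti hij))
      (by
        filter_upwards [ae_all_iff.2 fun n => chi_coe ν (B n) (hB n)] with x hx
        have hex : ∃ n, x ∉ B n := by
          by_contra hcon
          push Not at hcon
          have : x ∈ ⋂ n, B n := mem_iInter.2 hcon
          simp [hinter] at this
        obtain ⟨n, hn⟩ := hex
        refine tendsto_const_nhds.congr' ?_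
        filter_upwards [eventually_ge_atTop n] with k hk
        exact ((hx k).trans (indicator_of_notMem (fun h => hn (hanti hk h)) _)).symm)
    refine squeeze_zero (fun n => hφpos _ fun x => ?_) (fun n => ?_)
      (by simpa using hlim.const_mul (C : ℝ))
    · rw [indSimple_apply]
      exact indicator_nonneg (fun _ _ => zero_le_one) x
    · refine (hφabs _ fun x => ?_).trans ?_
      · rw [indSimple_apply]
        exact indicator_nonneg (fun _ _ => zero_le_one) x
      · refine ENNReal.toReal_le_of_le_ofReal (by positivity) ?_
        rw [ENNReal.ofReal_mul C.coe_nonneg, ENNReal.ofReal_coe_nnreal]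
        refine le_of_eq_of_le (l1Norm_congr_ae fun φ => ae_opMeasure hX hT ?_ φ)
          (hC (X.ind (B n) (hB n)))
        exact (X.coe_ofSimple (indSimple (B n) (hB n))).symm
  have hint : ∀ s : SimpleFunc Ω₁ ℝ, 0 ≤ s → ∫⁻ x, ‖s x‖ₑ ∂κ = ENNReal.ofReal (φ s) := fun s hs => by
    rw [← hκ, ← ofReal_integral_norm_eq_lintegral_enorm s.integrable_of_isFiniteMeasure]
    congr 1
    exact integral_congr_ae (Eventually.of_forall fun x => Real.norm_of_nonneg (hs x))
  have hdom : ∀ f : Ω₁ → ℝ, ∫⁻ x, ‖f x‖ₑ ∂κ ≤ l1Norm m f := fun f =>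
    lintegral_enorm_le_of_simpleFunc κ fun s hs0 hsf => by
      rw [hint s hs0]
      refine (ENNReal.ofReal_le_of_le_toReal (hφabs s hs0)).trans (l1Norm_mono fun x => ?_)
      rw [abs_of_nonneg (hs0 x)]
      exact hsf x
  have hac : κ ≪ ν := Measure.AbsolutelyContinuous.mk fun A hA h0 => by
    have h1 := hdom (A.indicator fun _ => 1)
    have h2 : l1Norm m (A.indicator fun _ => 1) = 0 := by
      rw [← le_zero_iff, ← l1Norm_congr_ae (f := fun _ => 0) fun φ => ae_opMeasure hX hT ?_ φ]
      · exact iSup₂_le fun φ _ => by simp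
      · filter_upwards [measure_eq_zero_iff_ae_notMem.1 h0] with x hx
        exact (indicator_of_notMem hx _).symm
    rw [h2] at h1
    simp_rw [enorm_indicator_eq_indicator_enorm] at h1
    rw [lintegral_indicator hA] at h1
    simpa using h1
  obtain ⟨w, hw0, hw⟩ := exists_weight κ hac
  refine ⟨w, ⟨hw0, fun f => by rw [hw]; exact hdom f⟩, fun s => ?_⟩
  rw [hw, ← lintegral_abs_rpow hp1 hp s κ]
  have h1 := hint (simpleAbsPow q s) (simpleAbsPow_nonneg q s)
  simp only [simpleAbsPow_apply] at h1
  rw [h1]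
  have h2 := hφt s
  beta_reduce at h2
  rw [inv_mul_le_iff₀ (by positivity)] at h2
  rw [← ENNReal.ofReal_toReal (ENNReal.rpow_ne_top_of_nonneg hq.le (hefin s) : e s ^ q ≠ ∞),
    ← ENNReal.ofReal_coe_nnreal, ← ENNReal.ofReal_mul K.coe_nonneg]
  exact ENNReal.ofReal_le_ofReal h2

theorem isConjugate_dominatedWeights [IsFiniteMeasure ν] (hp : p ≠ ∞) (hV0 : ∀ v ∈ V, 0 ≤ v)
    (hV : RelWeaklyCompact V) (hfac : PthPowerFactorable (weightMeasure V hV0 hV) p T)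
    {S : (Ω₁ →ₘ[ν] ℝ) → (Ω₂ →ₘ[μ] ℝ)}
    (hS : IsExtension (opMeasure hX hT) (weightMeasure V hV0 hV) p T S)
    (hreg : PRegular (opMeasure hX hT) (weightMeasure V hV0 hV) p S) :
    IsConjugate p V (dominatedWeights hX hT) T := by
  have hp1 : 1 ≤ p := Fact.out
  have hq : 0 < p.toReal := ENNReal.toReal_pos (one_pos.trans_le hp1).ne' hp
  obtain ⟨K₁, hK₁⟩ := hfac.exists_l1Norm_rpow_le hX hT hp hV0 hV
  obtain ⟨K, hK⟩ := hreg
  set D : ℝ≥0 := K₁ ^ p.toReal⁻¹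
  have hD : ∀ w ∈ dominatedWeights hX hT, ∀ f : X.carrier,
      eLpNorm (f : Ω₁ →ₘ[ν] ℝ) p (weighted ν w) ≤ D * ENNReal.ofReal (X.norm f) :=
    fun w hw f => eLpNorm_le_of_dominatedWeights hp hK₁ hw f
  refine ⟨fun w hw => hw.1, ⟨D, hD⟩, K + 1, fun v hv => ?_⟩
  have hmem : ∀ s : SimpleFunc Ω₁ ℝ,
      MemLpVec (opMeasure hX hT) p (X.ofSimple s : Ω₁ →ₘ[ν] ℝ) := fun s => by
    refine ⟨(X.ofSimple s : Ω₁ →ₘ[ν] ℝ).measurable, (memL1_simpleFunc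
      (simpleAbsPow p.toReal s)).congr ?_ fun φ => ae_opMeasure hX hT ?_ φ⟩
    · have := (X.ofSimple s : Ω₁ →ₘ[ν] ℝ).measurable
      fun_prop
    · filter_upwards [X.coe_ofSimple s] with x hx
      rw [simpleAbsPow_apply, hx]
  have hST : ∀ s : SimpleFunc Ω₁ ℝ,
      (S (X.ofSimple s : Ω₁ →ₘ[ν] ℝ) : Ω₂ → ℝ) =ᵐ[weighted μ v] T (X.ofSimple s) := fun s =>
    (hS.extends_op _ (hmem s)).ae hV0 hV ⟨v, hv⟩
  obtain ⟨w, hw, hws⟩ := exists_dominatedWeight hX hT hp (K := (K + 1) ^ p.toReal)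
    (by positivity) ⟨v, hv⟩ fun n f => by
      have h1 := ENNReal.rpow_le_rpow (hK n (fun i => X.ofSimple (f i)) fun i => hmem (f i)) hq.le
      rw [ENNReal.mul_rpow_of_nonneg _ _ hq.le, lpNormVec_rpow hp1 hp, lpNormVec_rpow hp1 hp] at h1
      simp_rw [abs_sum_rpow_rpow hq] at h1
      have h2 : l1Norm (opMeasure hX hT)
          (fun x => ∑ i, |(X.ofSimple (f i) : Ω₁ →ₘ[ν] ℝ) x| ^ p.toReal) =
          l1Norm (opMeasure hX hT) (∑ i, simpleAbsPow p.toReal (f i) : SimpleFunc Ω₁ ℝ) := by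
        refine l1Norm_congr_ae fun φ => ae_opMeasure hX hT ?_ φ
        filter_upwards [ae_all_iff.2 fun i => X.coe_ofSimple (f i)] with x hx
        rw [simpleFunc_sum_apply]
        exact Finset.sum_congr rfl fun i _ => by rw [hx i, simpleAbsPow_apply]
      rw [h2] at h1
      calc ∑ i, eLpNorm (T (X.ofSimple (f i))) p (weighted μ v) ^ p.toReal
          = ∑ i, eLpNorm (S (X.ofSimple (f i) : Ω₁ →ₘ[ν] ℝ)) p (weighted μ v) ^ p.toReal :=
            Finset.sum_congr rfl fun i _ => by rw [eLpNorm_congr_ae (hST (f i))]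
        _ = ∫⁻ y, ‖∑ i, |S (X.ofSimple (f i) : Ω₁ →ₘ[ν] ℝ) y| ^ p.toReal‖ₑ ∂weighted μ v :=
            sum_eLpNorm_rpow hp1 hp (fun i => (S _).measurable) _
        _ ≤ _ := lintegral_weighted_le_l1Norm hV0 hV ⟨v, hv⟩ _
        _ ≤ _ := h1
        _ ≤ _ := by
          gcongr
          rw [← ENNReal.coe_rpow_of_nonneg _ hq.le]
          exact ENNReal.coe_le_coe.2 (NNReal.rpow_le_rpow (by simp) hq.le)
  refine ⟨w, hw, ?_⟩
  have hJ : ∀ f : X.carrier, MemLp (f : Ω₁ →ₘ[ν] ℝ) p (weighted ν w) := fun f =>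
    memLp_of_eLpNorm_le (weighted_absolutelyContinuous w) (hD w hw f)
      (ENNReal.mul_lt_top ENNReal.coe_lt_top ENNReal.ofReal_lt_top)
  set J := toLpLin (weighted_absolutelyContinuous w) hJ with hJdef
  set R : X.carrier →ₗ[ℝ] Lp ℝ p (weighted μ v) :=
    (lp.evalₗ (𝕜 := ℝ) (fun v : V => Lp ℝ p (weighted μ v)) ∞ ⟨v, hv⟩).comp (opLin hT) with hR
  have hbs : ∀ s : SimpleFunc Ω₁ ℝ, ‖R (X.ofSimple s)‖ ≤ ((K + 1 : ℝ≥0) : ℝ) * ‖J (X.ofSimple s)‖ :=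
    fun s => by
      have h1 : ‖R (X.ofSimple s)‖ₑ ≤ (K + 1 : ℝ≥0) * ‖J (X.ofSimple s)‖ₑ := by
        have h2 : ‖R (X.ofSimple s)‖ₑ = eLpNorm (T (X.ofSimple s)) p (weighted μ v) :=
          enorm_opLin_apply hT _ ⟨v, hv⟩
        rw [h2, hJdef, enorm_toLpLin, eLpNorm_congr_ae
          ((weighted_absolutelyContinuous w).ae_eq (X.coe_ofSimple s)),
          ← ENNReal.rpow_le_rpow_iff hq, ENNReal.mul_rpow_of_nonneg _ _ hq.le,
          ← ENNReal.coe_rpow_of_nonneg _ hq.le]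
        exact hws s
      have h3 := ENNReal.toReal_mono (by finiteness) h1
      rwa [ENNReal.toReal_mul, toReal_enorm, toReal_enorm, ENNReal.coe_toReal] at h3
  have hRlim : ∀ {f : X.carrier} {g : ℕ → X.carrier},
      Tendsto (fun n => X.norm (f - g n)) atTop (𝓝 0) →
      Tendsto (fun n => R (g n)) atTop (𝓝 (R f)) := fun h =>
    ((lp.evalCLM ℝ (fun v : V => Lp ℝ p (weighted μ v)) ∞ ⟨v, hv⟩).continuous.tendsto _).comp
      (tendsto_opLin hT h)
  have hb : ∀ f : X.carrier, ‖R f‖ ≤ ((K + 1 : ℝ≥0) : ℝ) * ‖J f‖ := fun f => by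
    obtain ⟨s, hs⟩ := BanachFunctionSpace.exists_simpleFunc_tendsto hX f
    exact le_of_tendsto_of_tendsto' (hRlim hs).norm
      ((tendsto_toLpLin (weighted_absolutelyContinuous w) hJ (hD w hw) hs).norm.const_mul _)
      fun n => hbs (s n)
  have hdense := denseRange_toLpLin hp (weighted_absolutelyContinuous w) hJ
  refine ⟨R.extendOfNorm J, ContinuousLinearMap.opNorm_le_bound _ (K + 1).coe_nonneg
    (LinearMap.norm_extendOfNorm_apply_le hdense _ hb), fun f g hg => ?_⟩
  have hgJ : g = J f := Lp.ext (hg.trans (coe_toLpLin _ hJ f).symm)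
  rw [hgJ, LinearMap.extendOfNorm_eq hdense ⟨_, hb⟩]
  exact coe_opLin hT f ⟨v, hv⟩

end Forward

end ConjWeights

namespace ConjWeights

section Backward

variable {Ω₁ Ω₂ : Type*} [MeasurableSpace Ω₁] [MeasurableSpace Ω₂] {ν : Measure Ω₁}
  {μ : Measure Ω₂} {X : BanachFunctionSpace ν} {p : ℝ≥0∞} [Fact (1 ≤ p)] {V : Set (Lp ℝ 1 μ)}
  {T : X.carrier →ₗ[ℝ] (Ω₂ →ₘ[μ] ℝ)}

theorem opLin_mem_lpRange (hX : X.OrderContinuous) (hT : UniformlyBounded p V T) (hp : p ≠ ∞) (hV0 : ∀ v ∈ V, 0 ≤ v) (hV : RelWeaklyCompact V)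
    (hind : ∀ (A : Set Ω₁) (hA : MeasurableSet A),
      MemLpVec (weightMeasure V hV0 hV) p (T (X.ind A hA))) (f : X.carrier) :
    opLin hT f ∈ lpRange hV0 hV p := by
  have hs : ∀ s : SimpleFunc Ω₁ ℝ, opLin hT (X.ofSimple s) ∈ lpRange hV0 hV p := fun s => by
    induction s using SimpleFunc.induction with
    | @const c B hB =>
      rw [X.ofSimple_piecewise_const, map_smul]
      exact Submodule.smul_mem _ _ ⟨_, hind B hB, fun v => coe_opLin hT _ v⟩
    | @add s t _ hs ht =>
      rw [map_add, map_add]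
      exact Submodule.add_mem _ hs ht
  obtain ⟨s, hlim⟩ := BanachFunctionSpace.exists_simpleFunc_tendsto hX f
  exact (isClosed_lpRange hV0 hV hp).mem_of_tendsto (tendsto_opLin hT hlim)
    (Eventually.of_forall fun n => hs (s n))

theorem wellDefinedInto_of_ind (hX : X.OrderContinuous) (hT : UniformlyBounded p V T) (hp : p ≠ ∞) (hV0 : ∀ v ∈ V, 0 ≤ v) (hV : RelWeaklyCompact V)
    (hind : ∀ (A : Set Ω₁) (hA : MeasurableSet A),
      MemLpVec (weightMeasure V hV0 hV) p (T (X.ind A hA))) :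
    WellDefinedInto (weightMeasure V hV0 hV) p T := fun f => by
  obtain ⟨h, hh, hhf⟩ := opLin_mem_lpRange hX hT hp hV0 hV hind f
  exact hh.congr_weighted hV0 hV (T f).measurable fun v => (hhf v).symm.trans (coe_opLin hT f v)

variable (hX : X.OrderContinuous) (hT : UniformlyBounded p V T)

theorem lintegral_weighted_le_of_positivelyNorming {W : Set (Lp ℝ 1 ν)} {C : ℝ≥0}
    (hC : ∀ f : Ω₁ →ₘ[ν] ℝ, MemL1 (opMeasure hX hT) f →
      (⨆ w ∈ W, ∫⁻ x, ENNReal.ofReal (|f x| * w x) ∂ν) ≤ C * l1Norm (opMeasure hX hT) f)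
    {w : Lp ℝ 1 ν} (hw : w ∈ W) {f : Ω₁ → ℝ} (hf : MemL1 (opMeasure hX hT) f) :
    ∫⁻ x, ‖f x‖ₑ ∂weighted ν w ≤ C * l1Norm (opMeasure hX hT) f := by
  set g : Ω₁ →ₘ[ν] ℝ := AEEqFun.mk f hf.1.aestronglyMeasurable
  have hfg : (g : Ω₁ → ℝ) =ᵐ[ν] f := AEEqFun.coeFn_mk _ _
  have h1 := hC g (hf.congr g.measurable fun φ => ae_opMeasure hX hT hfg.symm φ)
  rw [l1Norm_congr_ae fun φ => ae_opMeasure hX hT hfg φ] at h1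
  refine le_trans (le_of_eq ?_) ((le_iSup₂ (f := fun (w : Lp ℝ 1 ν) (_ : w ∈ W) =>
    ∫⁻ x, ENNReal.ofReal (|g x| * w x) ∂ν) w hw).trans h1)
  rw [lintegral_mul_weight w g.measurable]
  refine lintegral_congr_ae ?_
  filter_upwards [(weighted_absolutelyContinuous w).ae_eq hfg] with x hx
  rw [hx]

theorem eLpNorm_le_l1Norm_opMeasure (f : X.carrier) (v : V) :
    eLpNorm (T f) p (weighted μ v) ≤ l1Norm (opMeasure hX hT) (f : Ω₁ →ₘ[ν] ℝ) := by
  rw [← enorm_opLin_apply hT]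
  refine le_trans ?_ (enorm_le_l1Norm (integral_opMeasure hX hT f))
  exact enorm_le_iff_norm_le.2 (lp.norm_apply_le_norm (by simp) (opLin hT f) v)

theorem pthPowerFactorable_of_norming (hp : p ≠ ∞) (hV0 : ∀ v ∈ V, 0 ≤ v)
    (hV : RelWeaklyCompact V) {W : Set (Lp ℝ 1 ν)} {c D : ℝ≥0} (hc0 : 0 < c)
    (hc : ∀ f : Ω₁ →ₘ[ν] ℝ, MemL1 (opMeasure hX hT) f →
      c * l1Norm (opMeasure hX hT) f ≤ ⨆ w ∈ W, ∫⁻ x, ENNReal.ofReal (|f x| * w x) ∂ν)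
    (hD : ∀ w ∈ W, ∀ f : X.carrier,
      eLpNorm (f : Ω₁ →ₘ[ν] ℝ) p (weighted ν w) ≤ D * ENNReal.ofReal (X.norm f)) :
    PthPowerFactorable (weightMeasure V hV0 hV) p T := by
  have hp1 : 1 ≤ p := Fact.out
  have hq : 0 < p.toReal := ENNReal.toReal_pos (one_pos.trans_le hp1).ne' hp
  refine ⟨c⁻¹ * D ^ p.toReal + 1, fun f => lpNormVec_weightMeasure_le hV0 hV hp1 hp fun v =>
    (eLpNorm_le_l1Norm_opMeasure hX hT f v).trans ?_⟩
  set g := absPow (1 / p.toReal) (f : Ω₁ →ₘ[ν] ℝ) with hg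
  by_cases hgX : g ∈ X.carrier
  · have hgf : (fun x => |g x| ^ p.toReal) =ᵐ[ν] fun x => |(f : Ω₁ →ₘ[ν] ℝ) x| := by
      filter_upwards [AEEqFun.coeFn_compMeasurable (fun t : ℝ => |t| ^ (1 / p.toReal))
        (by fun_prop) (f : Ω₁ →ₘ[ν] ℝ)] with x hx
      rw [hg, absPow, hx, Function.comp_apply, abs_of_nonneg (by positivity), one_div,
        Real.rpow_inv_rpow (abs_nonneg _) hq.ne']
    have h1 : c * l1Norm (opMeasure hX hT) (f : Ω₁ →ₘ[ν] ℝ) ≤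
        D ^ p.toReal * X.extNorm g ^ p.toReal := by
      refine (hc f (memL1_opMeasure hX hT f)).trans (iSup₂_le fun w hw => ?_)
      rw [lintegral_mul_weight w (f : Ω₁ →ₘ[ν] ℝ).measurable]
      have h2 : ∫⁻ x, ‖(f : Ω₁ →ₘ[ν] ℝ) x‖ₑ ∂weighted ν w =
          ∫⁻ x, ‖|g x| ^ p.toReal‖ₑ ∂weighted ν w := by
        refine lintegral_congr_ae ?_
        filter_upwards [(weighted_absolutelyContinuous w).ae_eq hgf] with x hx
        rw [hx, Real.enorm_abs]
      rw [h2, lintegral_abs_rpow hp1 hp, ← ENNReal.mul_rpow_of_nonneg _ _ hq.le,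
        X.extNorm_coe ⟨g, hgX⟩]
      exact ENNReal.rpow_le_rpow (hD w hw ⟨g, hgX⟩) hq.le
    have hc' : (c : ℝ≥0∞) ≠ 0 := by simpa using hc0.ne'
    calc l1Norm (opMeasure hX hT) (f : Ω₁ →ₘ[ν] ℝ)
        = (c : ℝ≥0∞)⁻¹ * (c * l1Norm (opMeasure hX hT) (f : Ω₁ →ₘ[ν] ℝ)) := by
          rw [← mul_assoc, ENNReal.inv_mul_cancel hc' ENNReal.coe_ne_top, one_mul]
      _ ≤ (c : ℝ≥0∞)⁻¹ * (D ^ p.toReal * X.extNorm g ^ p.toReal) := by gcongr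
      _ = ((c⁻¹ * D ^ p.toReal : ℝ≥0) : ℝ≥0∞) * X.extNorm g ^ p.toReal := by
          rw [ENNReal.coe_mul, ENNReal.coe_inv hc0.ne', ENNReal.coe_rpow_of_nonneg _ hq.le, mul_assoc]
      _ ≤ _ := by
          gcongr
          exact le_self_add
  · have h1 : X.extNorm g = ∞ := by simp [BanachFunctionSpace.extNorm, hgX]
    rw [h1, ENNReal.top_rpow_of_pos hq, ENNReal.mul_top]
    · exact le_top
    · simp

/-- A closed subspace that contains the values of a vector measure contains its integrals. -/
theorem integral_mem_of_isClosed {α E : Type*} [MeasurableSpace α] [NormedAddCommGroup E]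
    [NormedSpace ℝ E] {m : VectorMeasure α E} {L : Submodule ℝ E} (hL : IsClosed (L : Set E))
    (hm : ∀ A, MeasurableSet A → m A ∈ L) {f : α → ℝ} {A : Set α} {y : E}
    (hy : ∀ φ : StrongDual ℝ E, φ y = signedIntegral (scalarMeasure m φ) A f) : y ∈ L := by
  by_contra hyL
  obtain ⟨φ, u, hφL, hφy⟩ := geometric_hahn_banach_closed_point L.convex hL hyL
  have hu : 0 < u := by simpa using hφL 0 L.zero_mem
  have h0 : ∀ a ∈ L, φ a = 0 := fun a ha => by
    by_contra hne
    have := hφL ((u / φ a) • a) (L.smul_mem _ ha)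
    rw [map_smul, smul_eq_mul, div_mul_cancel₀ _ hne] at this
    exact lt_irrefl _ this
  have h1 : scalarMeasure m φ = 0 := by
    ext B hB
    exact h0 _ (hm B hB)
  have h2 := hy φ
  rw [h1] at h2
  have h3 : signedIntegral (0 : SignedMeasure α) A f = 0 := by
    unfold signedIntegral
    rw [SignedMeasure.toJordanDecomposition_zero]
    simp
  rw [h3] at h2
  linarith

/-- The integral `∫ f dm_T` of `f` in `L^p(m_T)`, as a function. -/
theorem exists_integral_function (hp : p ≠ ∞) (hV0 : ∀ v ∈ V, 0 ≤ v) (hV : RelWeaklyCompact V)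
    (hind : ∀ (A : Set Ω₁) (hA : MeasurableSet A),
      MemLpVec (weightMeasure V hV0 hV) p (T (X.ind A hA))) {f : Ω₁ → ℝ}
    (hf : MemLpVec (opMeasure hX hT) p f) :
    ∃ h : Ω₂ →ₘ[μ] ℝ, MemLpVec (weightMeasure V hV0 hV) p h ∧ ∃ y : RangeSpace p V,
      (∀ φ : StrongDual ℝ (RangeSpace p V),
        φ y = signedIntegral (scalarMeasure (opMeasure hX hT) φ) univ f) ∧
      ∀ v : V, y v =ᵐ[weighted μ v] h := by
  obtain ⟨y, hy⟩ := (hf.memL1 Fact.out hp).2.2 univ MeasurableSet.univ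
  obtain ⟨h, hh, hhy⟩ := integral_mem_of_isClosed (isClosed_lpRange hV0 hV hp)
    (fun A hA => by
      rw [opMeasure_apply hX hT hA]
      exact opLin_mem_lpRange hX hT hp hV0 hV hind _) hy
  exact ⟨h, hh, y, hy, hhy⟩

/-- The integral against `m_T`, at the coordinate `v`, is given by the operator induced by `T`. -/
theorem integral_apply_eq (hp : p ≠ ∞) (v : V) {w : Lp ℝ 1 ν}
    (R : Lp ℝ p (weighted ν w) →L[ℝ] Lp ℝ p (weighted μ v))
    (hR : ∀ (f : X.carrier) (g : Lp ℝ p (weighted ν w)), g =ᵐ[weighted ν w] (f : Ω₁ →ₘ[ν] ℝ) →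
      R g =ᵐ[weighted μ v] T f) {f : Ω₁ → ℝ} (hf : MemL1 (opMeasure hX hT) f)
    (hfw : MemLp f p (weighted ν w)) {y : RangeSpace p V}
    (hy : ∀ φ : StrongDual ℝ (RangeSpace p V),
      φ y = signedIntegral (scalarMeasure (opMeasure hX hT) φ) univ f) :
    y v = R (hfw.toLp f) := by
  have h0 : (0 : ℝ) ∈ range f ∪ {0} := by simp
  set s : ℕ → SimpleFunc Ω₁ ℝ := SimpleFunc.approxOn f hf.1 (range f ∪ {0}) 0 h0
  have hlim1 : ∀ x, Tendsto (fun n => s n x) atTop (𝓝 (f x)) := fun x =>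
    SimpleFunc.tendsto_approxOn hf.1 h0 (subset_closure (Or.inl ⟨x, rfl⟩))
  have hlim2 := ((R.continuous.tendsto _).comp (SimpleFunc.tendsto_approxOn_range_Lp hp hf.1 hfw))
  refine (SeparatingDual.eq_iff_forall_dual_eq (R := ℝ)).2 fun ψ => ?_
  set φ : StrongDual ℝ (RangeSpace p V) :=
    ψ.comp (lp.evalCLM ℝ (fun v : V => Lp ℝ p (weighted μ v)) ∞ v)
  change φ y = _
  rw [hy φ]
  have hlim3 := tendsto_signedIntegral (l := scalarMeasure (opMeasure hX hT) φ) univ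
    ((hf.2.1 φ).norm.add (hf.2.1 φ).norm) (fun n => (s n).measurable)
    (fun n x => SimpleFunc.norm_approxOn_zero_le hf.1 h0 x n) hlim1
  refine tendsto_nhds_unique hlim3 (((ψ.continuous.tendsto _).comp hlim2).congr fun n => ?_)
  rw [← integral_simpleFunc_opMeasure hX hT]
  change ψ (R _) = ψ (opLin hT (X.ofSimple (s n)) v)
  congr 1
  refine Lp.ext ((hR (X.ofSimple (s n)) _ ((MemLp.coeFn_toLp _).trans ?_)).trans
    (coe_opLin hT _ v).symm)
  exact ((weighted_absolutelyContinuous w).ae_eq (X.coe_ofSimple (s n))).symm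

theorem isExtension_of_integral (hV0 : ∀ v ∈ V, 0 ≤ v) (hV : RelWeaklyCompact V)
    {S : (Ω₁ →ₘ[ν] ℝ) → (Ω₂ →ₘ[μ] ℝ)}
    (hS : ∀ f : Ω₁ →ₘ[ν] ℝ, MemLpVec (opMeasure hX hT) p f →
      MemLpVec (weightMeasure V hV0 hV) p (S f) ∧ ∃ y : RangeSpace p V,
      (∀ φ : StrongDual ℝ (RangeSpace p V),
        φ y = signedIntegral (scalarMeasure (opMeasure hX hT) φ) univ f) ∧
      ∀ v : V, y v =ᵐ[weighted μ v] S f) (hp : p ≠ ∞) :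
    IsExtension (opMeasure hX hT) (weightMeasure V hV0 hV) p T S where
  mapsTo f hf := (hS f hf).1
  add f g hf hg := by
    have hfg : MemLpVec (opMeasure hX hT) p (f + g : Ω₁ →ₘ[ν] ℝ) := by
      have hm := (f + g).measurable
      refine ⟨hm, (hf.add hg).2.congr (by fun_prop) fun φ => ae_opMeasure hX hT ?_ φ⟩
      filter_upwards [AEEqFun.coeFn_add f g] with x hx
      rw [hx, Pi.add_apply]
    obtain ⟨-, y, hy, hyS⟩ := hS f hf
    obtain ⟨-, z, hz, hzS⟩ := hS g hg
    obtain ⟨-, u, hu, huS⟩ := hS _ hfg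
    have huyz : u = y + z := (SeparatingDual.eq_iff_forall_dual_eq (R := ℝ)).2 fun φ => by
      rw [map_add, hy, hz, hu, ← signedIntegral_add univ ((hf.memL1 Fact.out hp).2.1 φ)
        ((hg.memL1 Fact.out hp).2.1 φ)]
      exact signedIntegral_congr _ (ae_opMeasure hX hT (AEEqFun.coeFn_add f g) φ)
    refine eqModNull_of_ae hV0 hV (AEEqFun.measurable _) (AEEqFun.measurable _) fun v => ?_
    filter_upwards [hyS v, hzS v, huS v, Lp.coeFn_add (y v) (z v),
      (weighted_absolutelyContinuous _).ae_eq (AEEqFun.coeFn_add (S f) (S g))] with x h1 h2 h3 h4 h5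
    rw [h5, ← h3, huyz, Pi.add_apply, ← h1, ← h2]
    exact h4
  smul c f hf := by
    have hcf : MemLpVec (opMeasure hX hT) p (c • f : Ω₁ →ₘ[ν] ℝ) := by
      have hm := (c • f).measurable
      refine ⟨hm, (hf.const_mul c).2.congr (by fun_prop) fun φ => ae_opMeasure hX hT ?_ φ⟩
      filter_upwards [AEEqFun.coeFn_smul c f] with x hx
      rw [hx, Pi.smul_apply, smul_eq_mul]
    obtain ⟨-, y, hy, hyS⟩ := hS f hf
    obtain ⟨-, u, hu, huS⟩ := hS _ hcf
    have huy : u = c • y := (SeparatingDual.eq_iff_forall_dual_eq (R := ℝ)).2 fun φ => by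
      rw [map_smul, hy, hu, smul_eq_mul, ← signedIntegral_const_mul]
      exact signedIntegral_congr _ (ae_opMeasure hX hT (AEEqFun.coeFn_smul c f) φ)
    refine eqModNull_of_ae hV0 hV (AEEqFun.measurable _) (AEEqFun.measurable _) fun v => ?_
    filter_upwards [hyS v, huS v, Lp.coeFn_smul c (y v),
      (weighted_absolutelyContinuous _).ae_eq (AEEqFun.coeFn_smul c (S f))] with x h1 h3 h4 h5
    rw [h5, ← h3, huy, Pi.smul_apply, ← h1]
    exact h4
  extends_op f hf := by
    obtain ⟨-, y, hy, hyS⟩ := hS f hf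
    have hyf : y = opLin hT f := (SeparatingDual.eq_iff_forall_dual_eq (R := ℝ)).2 fun φ => by
      rw [hy, integral_opMeasure hX hT]
    refine eqModNull_of_ae hV0 hV (AEEqFun.measurable _) (AEEqFun.measurable _) fun v => ?_
    subst hyf
    exact (hyS v).symm.trans (coe_opLin hT f v)

theorem pRegular_of_integral (hp : p ≠ ∞) (hV0 : ∀ v ∈ V, 0 ≤ v) (hV : RelWeaklyCompact V)
    {S : (Ω₁ →ₘ[ν] ℝ) → (Ω₂ →ₘ[μ] ℝ)}
    (hS : ∀ f : Ω₁ →ₘ[ν] ℝ, MemLpVec (opMeasure hX hT) p f →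
      MemLpVec (weightMeasure V hV0 hV) p (S f) ∧ ∃ y : RangeSpace p V,
      (∀ φ : StrongDual ℝ (RangeSpace p V),
        φ y = signedIntegral (scalarMeasure (opMeasure hX hT) φ) univ f) ∧
      ∀ v : V, y v =ᵐ[weighted μ v] S f)
    {W : Set (Lp ℝ 1 ν)} (hW : PositivelyNorming (opMeasure hX hT) W) (hWT : IsConjugate p V W T) :
    PRegular (opMeasure hX hT) (weightMeasure V hV0 hV) p S := by
  have hp1 : 1 ≤ p := Fact.out
  have hq : 0 < p.toReal := ENNReal.toReal_pos (one_pos.trans_le hp1).ne' hp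
  obtain ⟨-, c, C, -, hC⟩ := hW
  obtain ⟨-, -, C', hC'⟩ := hWT
  refine ⟨C' * C ^ p.toReal⁻¹, fun n f hf => lpNormVec_weightMeasure_le hV0 hV hp1 hp fun v => ?_⟩
  obtain ⟨w, hw, R, hRC, hR⟩ := hC' v v.2
  have hdom : ∀ {g : Ω₁ → ℝ}, MemL1 (opMeasure hX hT) g →
      ∫⁻ x, ‖g x‖ₑ ∂weighted ν w ≤ C * l1Norm (opMeasure hX hT) g := fun hg =>
    lintegral_weighted_le_of_positivelyNorming hX hT (fun f hf => (hC f hf).2) hw hg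
  have hle : ∀ i, eLpNorm (S (f i)) p (weighted μ v) ≤ C' * eLpNorm (f i) p (weighted ν w) :=
    fun i => by
      have hfw : MemLp (f i) p (weighted ν w) := by
        refine ⟨(f i).measurable.aestronglyMeasurable, ?_⟩
        have h1 := (hdom (hf i).2).trans_lt
          (ENNReal.mul_lt_top ENNReal.coe_lt_top (hf i).2.l1Norm_lt_top)
        rw [lintegral_abs_rpow hp1 hp] at h1
        exact (ENNReal.rpow_lt_top_iff_of_pos hq).1 h1
      obtain ⟨-, y, hy, hyS⟩ := hS (f i) (hf i)
      have h2 := integral_apply_eq hX hT hp v R hR ((hf i).memL1 hp1 hp) hfw hy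
      rw [← eLpNorm_congr_ae (hyS v), ← Lp.enorm_def, h2, ← Lp.enorm_toLp hfw]
      refine (R.le_opENorm _).trans ?_
      gcongr
      rw [← ofReal_norm, ← ENNReal.ofReal_coe_nnreal]
      exact ENNReal.ofReal_le_ofReal hRC
  rw [← ENNReal.rpow_le_rpow_iff hq, ← lintegral_abs_rpow hp1 hp,
    ENNReal.mul_rpow_of_nonneg _ _ hq.le, lpNormVec_rpow hp1 hp]
  simp_rw [abs_sum_rpow_rpow hq]
  rw [← sum_eLpNorm_rpow hp1 hp fun i => (S (f i)).measurable]
  calc ∑ i, eLpNorm (S (f i)) p (weighted μ v) ^ p.toReal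
      ≤ ∑ i, (C' * eLpNorm (f i) p (weighted ν w)) ^ p.toReal :=
        Finset.sum_le_sum fun i _ => ENNReal.rpow_le_rpow (hle i) hq.le
    _ = C' ^ p.toReal * ∑ i, eLpNorm (f i) p (weighted ν w) ^ p.toReal := by
        rw [Finset.mul_sum]
        exact Finset.sum_congr rfl fun i _ => ENNReal.mul_rpow_of_nonneg _ _ hq.le
    _ ≤ C' ^ p.toReal * (C * l1Norm (opMeasure hX hT) fun x => ∑ i, |f i x| ^ p.toReal) := by
        rw [sum_eLpNorm_rpow hp1 hp fun i => (f i).measurable]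
        gcongr
        exact hdom (MemL1.sum _ fun i => (hf i).2)
    _ = _ := by
        rw [← mul_assoc, ENNReal.coe_mul, ENNReal.mul_rpow_of_nonneg _ _ hq.le,
          ENNReal.coe_rpow_of_nonneg _ (by positivity), ENNReal.rpow_inv_rpow hq.ne']

end Backward

end ConjWeights

theorem mainTheorem2 {Ω₁ Ω₂ : Type*} [MeasurableSpace Ω₁] [MeasurableSpace Ω₂]
    (ν : Measure Ω₁) [IsFiniteMeasure ν] (μ : Measure Ω₂) [IsFiniteMeasure μ]
    (p : ℝ≥0∞) [Fact (1 ≤ p)] (hp : p ≠ ∞)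
    (V : Set (Lp ℝ 1 μ)) (hV0 : ∀ v ∈ V, 0 ≤ v) (hV : ConjWeights.RelWeaklyCompact V)
    (X : ConjWeights.BanachFunctionSpace ν) (hX : X.OrderContinuous)
    (T : X.carrier →ₗ[ℝ] (Ω₂ →ₘ[μ] ℝ)) (hT : ConjWeights.UniformlyBounded p V T) :
    (ConjWeights.WellDefinedInto (ConjWeights.weightMeasure V hV0 hV) p T ∧
      ConjWeights.PthPowerFactorable (ConjWeights.weightMeasure V hV0 hV) p T ∧
      ∃ S : (Ω₁ →ₘ[ν] ℝ) → (Ω₂ →ₘ[μ] ℝ),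
        ConjWeights.IsExtension (ConjWeights.opMeasure hX hT)
          (ConjWeights.weightMeasure V hV0 hV) p T S ∧
        ConjWeights.PRegular (ConjWeights.opMeasure hX hT)
          (ConjWeights.weightMeasure V hV0 hV) p S) ↔
    ((∀ (A : Set Ω₁) (hA : MeasurableSet A),
        ConjWeights.MemLpVec (ConjWeights.weightMeasure V hV0 hV) p (T (X.ind A hA))) ∧
      (∃ K : ℝ≥0,
        ConjWeights.koetheBall ν (ConjWeights.L1Set ν (ConjWeights.opMeasure hX hT))
            (fun f => ConjWeights.l1Norm (ConjWeights.opMeasure hX hT) f) 1 ⊆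
          ConjWeights.koetheBall ν (X.carrier : Set (Ω₁ →ₘ[ν] ℝ)) X.extNorm K) ∧
      ∃ W : Set (Lp ℝ 1 ν),
        ConjWeights.PositivelyNorming (ConjWeights.opMeasure hX hT) W ∧
        ConjWeights.IsConjugate p V W T) := by
  constructor
  · rintro ⟨hwd, hfac, S, hS, hreg⟩
    exact ⟨fun A hA => hwd _, ConjWeights.exists_koetheBall_subset hX hT,
      ConjWeights.dominatedWeights hX hT, ConjWeights.positivelyNorming_dominatedWeights hX hT,
      ConjWeights.isConjugate_dominatedWeights hX hT hp hV0 hV hfac hS hreg⟩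
  · rintro ⟨hind, -, W, hW, hWT⟩
    obtain ⟨-, c, C, hc0, hcC⟩ := id hW
    obtain ⟨-, ⟨D, hD⟩, -⟩ := id hWT
    have hex : ∀ f : Ω₁ →ₘ[ν] ℝ, ∃ h : Ω₂ →ₘ[μ] ℝ,
        ConjWeights.MemLpVec (ConjWeights.opMeasure hX hT) p f →
        ConjWeights.MemLpVec (ConjWeights.weightMeasure V hV0 hV) p h ∧
        ∃ y : ConjWeights.RangeSpace p V, (∀ φ : StrongDual ℝ (ConjWeights.RangeSpace p V),
          φ y = ConjWeights.signedIntegral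
            (ConjWeights.scalarMeasure (ConjWeights.opMeasure hX hT) φ) univ f) ∧
        ∀ v : V, y v =ᵐ[ConjWeights.weighted μ v] h := fun f => by
      by_cases hf : ConjWeights.MemLpVec (ConjWeights.opMeasure hX hT) p f
      · obtain ⟨h, hh⟩ := ConjWeights.exists_integral_function hX hT hp hV0 hV hind hf
        exact ⟨h, fun _ => hh⟩
      · exact ⟨0, fun h => absurd h hf⟩
    choose S hS using hex
    exact ⟨ConjWeights.wellDefinedInto_of_ind hX hT hp hV0 hV hind,
      ConjWeights.pthPowerFactorable_of_norming hX hT hp hV0 hV hc0 (fun f hf => (hcC f hf).1) hD, S,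
      ConjWeights.isExtension_of_integral hX hT hV0 hV hS hp,
      ConjWeights.pRegular_of_integral hX hT hp hV0 hV hS hW hWT⟩
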